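/- Let $p\ge 1$, $q\ge 0$, $a_0>0$, $a_1,\dots,a_p\ge 0$, $b_1,\dots,b_q\ge 0$, and let $\nu$ be a probability distribution on $\mathbb N_0=\{0,1,2,\dots\}$ with mean $1$ and finite variance. A solution of the binomial count multiplicative error model $$X_t=\lfloor M_t\rfloor\,\epsilon_t+\mathrm{Bin}\big(\epsilon_t,\,M_t-\lfloor M_t\rfloor\big),\qquad M_t=a_0+\sum_{i=1}^p a_iX_{t-i}+\sum_{j=1}^q b_jM_{t-j},\qquad t\in\mathbb Z,$$ consists of processes $(X_t)$, $(\epsilon_t)$ with values in $\mathbb N_0$ and $(M_t)$ with values in $(0,\infty)$ on some probability space such that, with $\mathcal F_{t-1}=\sigma\big((X_s,M_s):s<t\big)$, the equations hold almost surely for every $t\in\mathbb Z$, the $\epsilon_t$ are i.i.d. with law $\nu$, each $\epsilon_t$ is independent of $\mathcal F_{t-1}$, and, conditionally on $\mathcal F_{t-1}$ and $\epsilon_t$, the second summand of $X_t$ has the binomial distribution with parameters $\epsilon_t$ and $M_t-\lfloor M_t\rfloor$. For a $\sigma$-field $\mathcal M$ and an integrable random vector $Z$ in $\mathbb R^l$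 put $$\tau(\mathcal M,Z)=E\Big[\sup_f\big|E[f(Z)\mid\mathcal M]-E[f(Z)]\big|\Big],$$ where $f$ ranges over the functions $\mathbb R^l\to\mathbb R$ that are $1$-Lipschitz for the norm $\sum_{i=1}^l|x_i|$ and $E[f(Z)\mid\mathcal M]$ is computed from a regular conditional distribution of $Z$ given $\mathcal M$. An integrable real-valued process $(X_t)_{t\in\mathbb Z}$ is called ($\tau$-)weakly dependent if $$\tau_\infty(r)=\sup_{l\ge 1}\ \frac1l\ \sup_{p'+r\le j_1<\dots<j_l}\tau\big(\sigma(X_s:s\le p'),\,(X_{j_1},\dots,X_{j_l})\big)\longrightarrow 0\qquad(r\to\infty),$$ where the inner supremum is over all integers $p',j_1,\dots,j_l$ with $p'+r\le j_1<\dots<j_l$. Theorem. If $\sum_{i=1}^p a_i+\sum_{j=1}^q b_j<1$, then there exists a solution of the model whose count process $(X_t)_{t\in\mathbb Z}$ is weakly dependent, strictly stationary and ergodic. -/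

import Mathlib

open MeasureTheory ProbabilityTheory Filter
open scoped ENNReal Topology

namespace CountMEM

/-- The left shift on two-sided sequences. -/
def shift {E : Type*} (x : ℤ → E) : ℤ → E := fun t => x (t + 1)

/-- The law of the whole path `(X_t)_{t ∈ ℤ}`. -/
noncomputable def pathLaw {Ω E : Type*} [MeasurableSpace Ω] [MeasurableSpace E]
    (X : ℤ → Ω → E) (μ : Measure Ω) : Measure (ℤ → E) :=
  μ.map (fun ω t => X t ω)

/-- Strict stationarity: the law of the path is invariant under the time shift. -/
def IsStationaryProcess {Ω E : Type*} [MeasurableSpace Ω] [MeasurableSpace E]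
    (X : ℤ → Ω → E) (μ : Measure Ω) : Prop :=
  MeasurePreserving shift (pathLaw X μ) (pathLaw X μ)

/-- Ergodicity: the time shift is ergodic for the law of the path. -/
def IsErgodicProcess {Ω E : Type*} [MeasurableSpace Ω] [MeasurableSpace E]
    (X : ℤ → Ω → E) (μ : Measure Ω) : Prop :=
  Ergodic shift (pathLaw X μ)

/-- Functions on `ℝ^l` that are 1-Lipschitz for the norm `|x_1| + ... + |x_l|`. -/
def IsL1Lipschitz {l : ℕ} (f : (Fin l → ℝ) → ℝ) : Prop :=
  ∀ x y, |f x - f y| ≤ ∑ i, |x i - y i|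

/-- The coefficient `τ(σ(Y), Z)`: the `L¹` norm of
`sup { |E[f(Z) | Y] - E[f(Z)]| : f 1-Lipschitz }`, where `E[f(Z) | Y]` is computed with a regular
conditional distribution of `Z` given `Y`. -/
noncomputable def tauCoeff {Ω β : Type*} [MeasurableSpace Ω] [MeasurableSpace β] {l : ℕ}
    (μ : Measure Ω) [IsFiniteMeasure μ] (Y : Ω → β) (Z : Ω → Fin l → ℝ) : ℝ≥0∞ :=
  ∫⁻ ω, ⨆ (f : (Fin l → ℝ) → ℝ) (_ : IsL1Lipschitz f),
    ENNReal.ofReal |(∫ z, f z ∂(condDistrib Z Y μ (Y ω))) - ∫ ω', f (Z ω') ∂μ| ∂μ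

/-- The path of a process up to and including time `p`. -/
def pathUpTo {Ω : Type*} (X : ℤ → Ω → ℝ) (p : ℤ) (ω : Ω) : {s : ℤ // s ≤ p} → ℝ :=
  fun s => X s ω

/-- `τ_∞(r)`: the supremum over `l ≥ 1` and over `p + r ≤ j_1 < ... < j_l` of
`τ(σ(X_s, s ≤ p), (X_{j_1}, ..., X_{j_l})) / l`. -/
noncomputable def tauInfty {Ω : Type*} [MeasurableSpace Ω]
    (X : ℤ → Ω → ℝ) (μ : Measure Ω) [IsFiniteMeasure μ] (r : ℕ) : ℝ≥0∞ :=
  ⨆ (l : ℕ) (_ : 1 ≤ l) (p : ℤ) (j : Fin l → ℤ) (_ : StrictMono j) (_ : ∀ i, p + r ≤ j i),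
    tauCoeff μ (pathUpTo X p) (fun ω i => X (j i) ω) / l

/-- `τ`-weak dependence of an integrable real-valued process: `τ_∞(r) → 0` as `r → ∞`. -/
def IsTauWeaklyDependent {Ω : Type*} [MeasurableSpace Ω]
    (X : ℤ → Ω → ℝ) (μ : Measure Ω) [IsFiniteMeasure μ] : Prop :=
  (∀ t, Integrable (X t) μ) ∧ Tendsto (tauInfty X μ) atTop (𝓝 0)

/-- The σ-field `F_{t-1}` generated by `(X_s, M_s)`, `s < t`. -/
@[reducible] def pastSigma {Ω : Type*} (X : ℤ → Ω → ℕ) (M : ℤ → Ω → ℝ) (t : ℤ) : MeasurableSpace Ω :=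
  ⨆ (s : ℤ) (_ : s < t), MeasurableSpace.comap (fun ω => (X s ω, M s ω)) inferInstance

/-- The fractional part `x - ⌊x⌋`, as a point of the unit interval. -/
noncomputable def fracPart (x : ℝ) : unitInterval := ⟨Int.fract x, unitInterval.fract_mem x⟩

/-- `(X, M, ε)` is a solution on `(Ω, μ)` of the INGARCH`(p,q)` count multiplicative error model
`X_t = ⌊M_t⌋ ε_t + Bin(ε_t, M_t - ⌊M_t⌋)` with linear conditional mean
`M_t = a₀ + ∑_{i=1}^p a_i X_{t-i} + ∑_{j=1}^q b_j M_{t-j}` and i.i.d. innovations of law `ν`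
(`a i` and `b j` with `i : Fin p`, `j : Fin q` are the coefficients `a_{i+1}`, `b_{j+1}`). -/
structure IsBinomialCMEM {Ω : Type*} [MeasurableSpace Ω] (μ : Measure Ω) {p q : ℕ}
    (a₀ : ℝ) (a : Fin p → ℝ) (b : Fin q → ℝ) (ν : Measure ℕ)
    (X : ℤ → Ω → ℕ) (M : ℤ → Ω → ℝ) (ε : ℤ → Ω → ℕ) : Prop where
  measurable_X : ∀ t, Measurable (X t)
  measurable_M : ∀ t, Measurable (M t)
  measurable_ε : ∀ t, Measurable (ε t)
  /-- the innovations are i.i.d. with law `ν` -/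
  iIndep_ε : iIndepFun ε μ
  law_ε : ∀ t, μ.map (ε t) = ν
  /-- `ε_t` is independent of `F_{t-1}` -/
  indep_past : ∀ t, Indep (MeasurableSpace.comap (ε t) inferInstance) (pastSigma X M t) μ
  /-- `M_t` is truly positive and satisfies the linear mean recursion -/
  pos_M : ∀ t, ∀ᵐ ω ∂μ, 0 < M t ω
  mean_eq : ∀ t, ∀ᵐ ω ∂μ, M t ω = a₀ + ∑ i : Fin p, a i * (X (t - ((i : ℤ) + 1)) ω : ℝ)
      + ∑ j : Fin q, b j * M (t - ((j : ℤ) + 1)) ω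
  /-- `X_t = ⌊M_t⌋ ε_t + B` where, given `F_{t-1}` and `ε_t`, the count `B` has the binomial
  distribution with parameters `ε_t` and `M_t - ⌊M_t⌋` -/
  binomial_eq : ∀ t, ∃ B : Ω → ℕ, Measurable B ∧
    (∀ᵐ ω ∂μ, (X t ω : ℤ) = ⌊M t ω⌋ * (ε t ω : ℤ) + (B ω : ℤ)) ∧
    ∀ k : ℕ, μ⟦B ⁻¹' {k} | pastSigma X M t ⊔ MeasurableSpace.comap (ε t) inferInstance⟧
      =ᵐ[μ] fun ω => (binomial (ε t ω) (fracPart (M t ω))).real {k}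

end CountMEM

/-! Enrich each innovation by a sequence of i.i.d. uniforms `U_k` and, for mean `m`, take as count
the sum of `⌈m - U_k⌉₊` over `k < ε`. Almost surely this is `⌊m⌋ ε` plus the number of `U_k` below
the fractional part of `m`, i.e. the binomial model (`count_eq_floor_add_thin`, `map_thin`). In this
form the count is increasing and left-continuous in `m`, and its expectation is `m` because `ν` has
mean 1 (`lintegral_count`).

Hence the Picard iterates of the mean recursion, started from 0, increase pathwise. With `ρ = ∑ a +
∑ b`, the expectation of iterate `n` is `a₀ (1 + ρ + ... + ρ^(n-1))`. As `ρ < 1`, the supremum is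
almost surely finite, and left-continuity carries the recursion to the limit (`meanProc_eq`).
Monotonicity makes the `L¹` error a difference of expectations, which tends to 0
(`lintegral_abs_countProc_sub`, `tendsto_picardError`).

Iterate `n` at time `t` reads only innovations in `[t - n(p+q), t]`. Across a longer gap it is
independent of the past, so `tauCoeff_le` bounds `τ_∞` by twice the `L¹` error. Stationarity and
ergodicity hold because the count path is a factor of the Bernoulli shift (`ergodic_shift`). -/

namespace CountMEM

/-! ### Coordinate σ-fields and ergodicity of the Bernoulli shift. -/

section Coordinates

variable {E : Type*} [MeasurableSpace E]

/-- The σ-field generated by the coordinates in `I`. -/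
@[reducible] def coordSigma (E : Type*) [MeasurableSpace E] (I : Set ℤ) : MeasurableSpace (ℤ → E) :=
  ⨆ s ∈ I, MeasurableSpace.comap (fun ω : ℤ → E => ω s) inferInstance

lemma coordSigma_le (I : Set ℤ) : coordSigma E I ≤ MeasurableSpace.pi :=
  iSup₂_le fun s _ => (measurable_pi_apply s).comap_le

lemma coordSigma_mono {I J : Set ℤ} (h : I ⊆ J) : coordSigma E I ≤ coordSigma E J :=
  biSup_mono h

lemma measurable_coord {I : Set ℤ} {s : ℤ} (hs : s ∈ I) :
    Measurable[coordSigma E I] (fun ω : ℤ → E => ω s) :=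
  Measurable.of_comap_le (le_iSup₂_of_le s hs le_rfl)

lemma indep_coordSigma (P : Measure E) [IsProbabilityMeasure P] {I J : Set ℤ} (h : Disjoint I J) :
    Indep (coordSigma E I) (coordSigma E J) (Measure.infinitePi fun _ : ℤ => P) :=
  indep_iSup_of_disjoint (fun s => (measurable_pi_apply s).comap_le)
    (iIndepFun_infinitePi (P := fun _ : ℤ => P) (X := fun _ x => x)
      (fun _ => measurable_id)).iIndep h

lemma measurable_shift : Measurable (shift : (ℤ → E) → ℤ → E) :=
  measurable_pi_lambda _ fun t => measurable_pi_apply (t + 1)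

lemma shift_iterate {E : Type*} (n : ℕ) (x : ℤ → E) (t : ℤ) : (shift^[n] x) t = x (t + n) := by
  induction n generalizing x with
  | zero => simp
  | succ n ih =>
    rw [Function.iterate_succ_apply, ih]
    simp only [shift]
    congr 1
    push_cast
    ring

/-- Moving the window `[-N, N]` by `n > 2N` puts it strictly to the right of `N`, hence disjoint
from the original window; this gives independence in the mixing argument. -/
lemma measurable_shift_iterate_coordSigma (n N : ℕ) (hn : 2 * N < n) :
    Measurable[coordSigma E (Set.Ioi (N : ℤ)), coordSigma E (Set.Icc (-(N : ℤ)) N)]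
      (shift^[n] : (ℤ → E) → ℤ → E) := by
  refine Measurable.of_le_map (iSup₂_le fun s hs => ?_)
  rw [MeasurableSpace.comap_le_iff_le_map, MeasurableSpace.map_comp]
  refine Measurable.le_map ?_
  have : (fun ω : ℤ → E => ω s) ∘ shift^[n] = fun ω => ω (s + n) := by
    ext ω
    exact shift_iterate n ω s
  rw [this]
  refine measurable_coord ?_
  simp only [Set.mem_Ioi, Set.mem_Icc] at *
  omega

variable (P : Measure E) [IsProbabilityMeasure P]

lemma measurePreserving_shift :
    MeasurePreserving (shift : (ℤ → E) → ℤ → E) (Measure.infinitePi fun _ => P)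
      (Measure.infinitePi fun _ => P) :=
  ⟨measurable_shift, Measure.map_infinitePi_infinitePi_of_inj (P := fun _ : ℤ => P)
    (f := fun t : ℤ => t + 1) (add_left_injective 1)⟩

/-- The sets depending on finitely many coordinates. -/
def cylinderSets (E : Type*) [MeasurableSpace E] : Set (Set (ℤ → E)) :=
  ⋃ N : ℕ, {s | MeasurableSet[coordSigma E (Set.Icc (-(N : ℤ)) N)] s}

lemma isPiSystem_cylinderSets : IsPiSystem (cylinderSets E) :=
  isPiSystem_iUnion_of_monotone _ (fun N => @MeasurableSpace.isPiSystem_measurableSet _ (coordSigma E (Set.Icc (-(N : ℤ)) N)))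
    fun _ _ h _ hs => coordSigma_mono (Set.Icc_subset_Icc (by simpa using h) (by simpa using h)) _ hs

lemma generateFrom_cylinderSets :
    (MeasurableSpace.pi : MeasurableSpace (ℤ → E)) =
      MeasurableSpace.generateFrom (cylinderSets E) := by
  rw [cylinderSets, MeasurableSpace.generateFrom_iUnion_measurableSet
    (fun N : ℕ => coordSigma E (Set.Icc (-(N : ℤ)) N))]
  refine le_antisymm (iSup_le fun s => ?_) (iSup_le fun N => coordSigma_le _)
  refine le_iSup_of_le s.natAbs (le_iSup₂_of_le s ?_ le_rfl)
  simp only [Set.mem_Icc]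
  omega

lemma measurableSet_of_mem_cylinderSets {C : Set (ℤ → E)} (hC : C ∈ cylinderSets E) :
    MeasurableSet C := by
  rw [generateFrom_cylinderSets]
  exact MeasurableSpace.measurableSet_generateFrom hC

/-- The Bernoulli shift is mixing. -/
lemma tendsto_measure_inter_shift_preimage {C : Set (ℤ → E)} (hC : C ∈ cylinderSets E)
    {B : Set (ℤ → E)} (hB : MeasurableSet B) :
    Tendsto (fun n : ℕ => (Measure.infinitePi fun _ => P) (B ∩ shift^[n] ⁻¹' C)) atTop
      (𝓝 ((Measure.infinitePi fun _ => P) B * (Measure.infinitePi fun _ => P) C)) := by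
  set μ : Measure (ℤ → E) := Measure.infinitePi fun _ => P with hμ
  have hCm := measurableSet_of_mem_cylinderSets hC
  have hpre (n : ℕ) : MeasurableSet (shift^[n] ⁻¹' C) := measurable_shift.iterate n hCm
  have hmC (n : ℕ) : μ (shift^[n] ⁻¹' C) = μ C :=
    ((measurePreserving_shift P).iterate n).measure_preimage hCm.nullMeasurableSet
  obtain ⟨N, hN⟩ := Set.mem_iUnion.1 hC
  -- With `C` a fixed cylinder, the sets `B` satisfying the limit form a λ-system that contains the
  -- cylinders.
  induction B, hB using MeasurableSpace.induction_on_inter generateFrom_cylinderSets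
    isPiSystem_cylinderSets with
  | empty => simp
  | basic B hB =>
    obtain ⟨K, hK⟩ := Set.mem_iUnion.1 hB
    -- For two cylinders in a common window the events become independent after a large shift, so
    -- the sequence is eventually constant.
    refine tendsto_const_nhds.congr' ?_
    filter_upwards [eventually_gt_atTop (2 * max N K)] with n hn
    have hle {L : ℕ} (h : L ≤ max N K) :
        Set.Icc (-(L : ℤ)) L ⊆ Set.Icc (-((max N K : ℕ) : ℤ)) (max N K : ℕ) :=
      Set.Icc_subset_Icc (by simpa using h) (by simpa using h)
    have h1 : MeasurableSet[coordSigma E (Set.Ioi ((max N K : ℕ) : ℤ))] (shift^[n] ⁻¹' C) :=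
      measurable_shift_iterate_coordSigma n _ hn (coordSigma_mono (hle (le_max_left _ _)) _ hN)
    have h2 : Disjoint (Set.Icc (-((max N K : ℕ) : ℤ)) (max N K : ℕ))
        (Set.Ioi ((max N K : ℕ) : ℤ)) := by
      rw [Set.disjoint_left]
      intro x hx hx'
      exact absurd hx.2 (not_le.2 hx')
    rw [(Indep_iff _ _ _).1 (indep_coordSigma P h2) _ _
      (coordSigma_mono (hle (le_max_right _ _)) _ hK) h1, ← hμ, hmC]
  | compl B hB ih =>
    have h (n : ℕ) : μ (Bᶜ ∩ shift^[n] ⁻¹' C) = μ C - μ (B ∩ shift^[n] ⁻¹' C) := by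
      rw [← hmC n, Set.inter_comm, Set.inter_comm B, ← Set.sdiff_eq, ← Set.sdiff_inter_self_eq_sdiff,
        measure_sdiff Set.inter_subset_right (hB.inter (hpre n)).nullMeasurableSet
          (measure_ne_top _ _), Set.inter_comm B]
    simp_rw [h]
    have h2 : μ Bᶜ * μ C = μ C - μ B * μ C := by
      rw [prob_compl_eq_one_sub hB, ENNReal.sub_mul (fun _ _ => measure_ne_top _ _), one_mul]
    rw [h2]
    exact ENNReal.Tendsto.sub tendsto_const_nhds ih (Or.inl (measure_ne_top _ _))
  | iUnion f hd hf ih =>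
    have h (n : ℕ) : μ ((⋃ i, f i) ∩ shift^[n] ⁻¹' C) = ∑' i, μ (f i ∩ shift^[n] ⁻¹' C) := by
      rw [Set.iUnion_inter, measure_iUnion _ fun i => (hf i).inter (hpre n)]
      exact fun i j hij => (hd hij).mono Set.inter_subset_left Set.inter_subset_left
    simp_rw [h]
    rw [measure_iUnion hd hf, ← ENNReal.tsum_mul_right]
    have hsum : ∑' i, μ (f i) ≠ ∞ := by
      rw [← measure_iUnion hd hf]
      exact measure_ne_top _ _
    -- The series is an integral against counting measure, dominated by the summable `μ (f i)`.
    simp_rw [← lintegral_count] at hsum ⊢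
    exact tendsto_lintegral_of_dominated_convergence (fun i => μ (f i))
      (fun _ => measurable_of_countable _)
      (fun n => Eventually.of_forall fun i => measure_mono Set.inter_subset_left) hsum
      (Eventually.of_forall fun i => ih i)

/-- The Bernoulli shift is ergodic. -/
theorem ergodic_shift :
    Ergodic (shift : (ℤ → E) → ℤ → E) (Measure.infinitePi fun _ => P) := by
  refine ⟨measurePreserving_shift P, ⟨fun A hA hinv => ?_⟩⟩
  set μ : Measure (ℤ → E) := Measure.infinitePi fun _ => P with hμ
  have hiter (n : ℕ) : shift^[n] ⁻¹' A = A := by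
    induction n with
    | zero => rfl
    | succ n ih => rw [Function.iterate_succ, Set.preimage_comp, ih, hinv]
  -- Invariance of `A` makes `μ (A ∩ shift^[n] ⁻¹' C)` constant in `n`, while mixing gives its
  -- limit. So `A` is independent of every cylinder, and then of itself.
  have hcyl : ∀ C ∈ cylinderSets E, μ (A ∩ C) = μ A * μ C := by
    intro C hC
    refine tendsto_nhds_unique (f := fun _ : ℕ => μ (A ∩ C)) (l := atTop) tendsto_const_nhds ?_
    refine (tendsto_measure_inter_shift_preimage P hC hA).congr fun n => ?_
    have hAC := (hA.inter (measurableSet_of_mem_cylinderSets hC)).nullMeasurableSet (μ := μ)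
    rw [← ((measurePreserving_shift P).iterate n).measure_preimage hAC, Set.preimage_inter, hiter]
  have hext : μ.restrict A = μ A • μ := by
    refine ext_of_generate_finite _ generateFrom_cylinderSets isPiSystem_cylinderSets ?_ ?_
    · intro C hC
      rw [Measure.restrict_apply (measurableSet_of_mem_cylinderSets hC), Set.inter_comm, hcyl C hC]
      rfl
    · simp
  have hsq : μ A = μ A * μ A := by
    have := congrArg (fun κ => κ A) hext
    simpa [Measure.restrict_apply_self] using this
  have h01 : μ A = 0 ∨ μ A = 1 := by
    by_cases h0 : μ A = 0
    · exact Or.inl h0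
    · right
      have h := (ENNReal.mul_eq_left h0 (measure_ne_top μ A)).1 hsq.symm
      exact h
  rw [eventuallyConst_set']
  rcases h01 with h | h
  · exact Or.inl (ae_eq_empty.2 h)
  · exact Or.inr (ae_eq_univ.2 ((prob_compl_eq_zero_iff hA).2 h))

end Coordinates

/-! ### Independence and conditional probabilities. -/

section Independence

variable {Ω α β γ : Type*} {mΩ : MeasurableSpace Ω} [MeasurableSpace α] [MeasurableSpace β]
  [MeasurableSpace γ] {μ : Measure Ω}

/-- The joint law is `F ⊗ (V ⊗ W)`, and reassociating the product yields the claim. -/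
lemma IndepFun.prodMk_left [IsProbabilityMeasure μ] {F : Ω → α} {V : Ω → β} {W : Ω → γ}
    (hF : Measurable F) (hV : Measurable V) (hW : Measurable W)
    (h : IndepFun F (fun ω => (V ω, W ω)) μ) (h' : IndepFun V W μ) :
    IndepFun (fun ω => (F ω, V ω)) W μ := by
  have hFV : IndepFun F V μ := h.comp (φ := id) (ψ := Prod.fst) measurable_id measurable_fst
  have : IsProbabilityMeasure (μ.map F) := Measure.isProbabilityMeasure_map hF.aemeasurable
  have : IsProbabilityMeasure (μ.map V) := Measure.isProbabilityMeasure_map hV.aemeasurable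
  have : IsProbabilityMeasure (μ.map W) := Measure.isProbabilityMeasure_map hW.aemeasurable
  rw [indepFun_iff_map_prod_eq_prod_map_map (hF.prodMk hV).aemeasurable hW.aemeasurable,
    (indepFun_iff_map_prod_eq_prod_map_map hF.aemeasurable hV.aemeasurable).1 hFV]
  have h1 := (indepFun_iff_map_prod_eq_prod_map_map hF.aemeasurable
    (hV.prodMk hW).aemeasurable).1 h
  rw [(indepFun_iff_map_prod_eq_prod_map_map hV.aemeasurable hW.aemeasurable).1 h',
    ← Measure.prodAssoc_prod] at h1
  have h2 := congrArg (Measure.map MeasurableEquiv.prodAssoc.symm) h1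
  rw [Measure.map_map (MeasurableEquiv.measurable _) (hF.prodMk (hV.prodMk hW)),
    Measure.map_map (MeasurableEquiv.measurable _) (MeasurableEquiv.measurable _),
    MeasurableEquiv.symm_comp_self, Measure.map_id] at h2
  exact h2

/-- Conditional probabilities of events depending on an `m`-measurable variable and
on a variable independent of `m`. -/
lemma condExp_indicator_of_indep {Ω : Type*} {m mΩ : MeasurableSpace Ω} {μ : Measure Ω}
    [IsProbabilityMeasure μ] (hm : m ≤ mΩ)
    {A : Ω → α} (hA : Measurable[m] A) {V : Ω → β} (hV : Measurable V)
    (hind : Indep m (MeasurableSpace.comap V inferInstance) μ) {s : Set (α × β)}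
    (hs : MeasurableSet s) :
    μ⟦(fun ω => (A ω, V ω)) ⁻¹' s | m⟧ =ᵐ[μ] fun ω => (μ.map V).real (Prod.mk (A ω) ⁻¹' s) := by
  have hA' : Measurable A := hA.mono hm le_rfl
  have : IsProbabilityMeasure (μ.map V) := Measure.isProbabilityMeasure_map hV.aemeasurable
  have hpre : MeasurableSet ((fun ω => (A ω, V ω)) ⁻¹' s) := (hA'.prodMk hV) hs
  have hker : Measurable fun a : α => (μ.map V) (Prod.mk a ⁻¹' s) :=
    measurable_measure_prodMk_left hs
  have hmeas : Measurable[m] fun ω => (μ.map V).real (Prod.mk (A ω) ⁻¹' s) :=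
    (hker.ennreal_toReal).comp hA
  have hle : ∀ ω, ‖(μ.map V).real (Prod.mk (A ω) ⁻¹' s)‖ ≤ 1 := fun ω => by
    rw [Real.norm_of_nonneg measureReal_nonneg]
    exact measureReal_le_one
  refine (ae_eq_condExp_of_forall_setIntegral_eq hm ?_ ?_ ?_ ?_).symm
  · exact (integrable_const _).indicator hpre
  · intro D hD _
    exact (Integrable.of_bound (hmeas.mono hm le_rfl).aestronglyMeasurable 1
      (Eventually.of_forall hle)).integrableOn
  · intro D hD _
    have hD' := hm D hD
    -- Restricting to `D ∈ m` keeps the product structure, since `A⁻¹ a ∩ D` is still in `m`; the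
    -- set integral is then computed by Fubini.
    have hprod : (μ.restrict D).map (fun ω => (A ω, V ω))
        = ((μ.restrict D).map A).prod (μ.map V) := by
      refine (Measure.prod_eq fun a b ha hb => ?_).symm
      rw [Measure.map_apply (hA'.prodMk hV) (ha.prod hb), Measure.map_apply hA' ha,
        Measure.map_apply hV hb, Measure.restrict_apply ((hA'.prodMk hV) (ha.prod hb)),
        Measure.restrict_apply (hA' ha)]
      rw [← (Indep_iff _ _ _).1 hind _ _ ((hA ha).inter hD) ⟨b, hb, rfl⟩]
      congr 1
      ext ω
      simp only [Set.mem_inter_iff, Set.mem_preimage, Set.mem_prod]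
      tauto
    rw [integral_indicator hpre, setIntegral_const, smul_eq_mul, mul_one]
    simp only [measureReal_def]
    have hcomp : Measurable fun ω => (μ.map V) (Prod.mk (A ω) ⁻¹' s) := hker.comp hA'
    rw [integral_toReal hcomp.aemeasurable
      (Eventually.of_forall fun ω => measure_lt_top _ _)]
    congr 1
    rw [← Measure.map_apply (hA'.prodMk hV) hs, hprod, Measure.prod_apply hs,
      lintegral_map hker hA']
  · exact hmeas.aestronglyMeasurable

end Independence

/-! ### Bounding the `τ`-coefficient by a coupling. -/

section Tau

variable {Ω β : Type*} {mΩ : MeasurableSpace Ω} [MeasurableSpace β] {μ : Measure Ω} {l : ℕ}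

lemma IsL1Lipschitz.continuous {f : (Fin l → ℝ) → ℝ} (hf : IsL1Lipschitz f) : Continuous f := by
  rw [continuous_iff_continuousAt]
  intro x
  rw [ContinuousAt, tendsto_iff_dist_tendsto_zero]
  have h : Tendsto (fun y : Fin l → ℝ => ∑ i, |y i - x i|) (𝓝 x) (𝓝 0) := by
    have : Continuous fun y : Fin l → ℝ => ∑ i, |y i - x i| := by fun_prop
    simpa using this.tendsto x
  exact squeeze_zero (fun _ => dist_nonneg) (fun y => hf y x) h

lemma IsL1Lipschitz.integrable {f : (Fin l → ℝ) → ℝ} (hf : IsL1Lipschitz f) {α : Type*}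
    {mα : MeasurableSpace α} {κ : Measure α} [IsFiniteMeasure κ] {Z : α → Fin l → ℝ}
    (hZ : Measurable Z) (hint : ∀ i, Integrable (fun a => Z a i) κ) :
    Integrable (fun a => f (Z a)) κ := by
  have hb : Integrable (fun a => |f 0| + ∑ i, |Z a i|) κ :=
    (integrable_const _).add (integrable_finsetSum _ fun i _ => (hint i).abs)
  refine hb.mono' (hf.continuous.measurable.comp hZ).aestronglyMeasurable
    (Eventually.of_forall fun a => ?_)
  have h1 := hf (Z a) 0
  simp only [Pi.zero_apply, sub_zero] at h1
  rw [Real.norm_eq_abs]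
  have := abs_sub_abs_le_abs_sub (f (Z a)) (f 0)
  linarith

/-- Two integrals of a Lipschitz function differ by at most the transport cost of a coupling. -/
lemma IsL1Lipschitz.ofReal_abs_integral_sub_le {f : (Fin l → ℝ) → ℝ} (hf : IsL1Lipschitz f)
    {α : Type*} {mα : MeasurableSpace α} {κ : Measure α} [IsFiniteMeasure κ] {Z Z' : α → Fin l → ℝ}
    (hZ : Measurable Z) (hint : ∀ i, Integrable (fun a => Z a i) κ)
    (hZ' : Measurable Z') (hint' : ∀ i, Integrable (fun a => Z' a i) κ) :
    ENNReal.ofReal |∫ a, f (Z a) ∂κ - ∫ a, f (Z' a) ∂κ|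
      ≤ ∫⁻ a, ENNReal.ofReal (∑ i, |Z a i - Z' a i|) ∂κ := by
  rw [← integral_sub (hf.integrable hZ hint) (hf.integrable hZ' hint')]
  have hb : Integrable (fun a => ∑ i, |Z a i - Z' a i|) κ :=
    integrable_finsetSum _ fun i _ => ((hint i).sub (hint' i)).abs
  rw [← ofReal_integral_eq_lintegral_ofReal hb
    (Eventually.of_forall fun a => Finset.sum_nonneg fun i _ => abs_nonneg _)]
  refine ENNReal.ofReal_le_ofReal (abs_integral_le_integral_abs.trans ?_)
  exact integral_mono ((hf.integrable hZ hint).sub (hf.integrable hZ' hint')).abs hb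
    fun a => hf _ _

/-- The `τ`-coefficient is controlled by the distance to a vector independent of the past. -/
theorem tauCoeff_le [IsProbabilityMeasure μ] {Y : Ω → β} (hY : Measurable Y) {Z Z' : Ω → Fin l → ℝ}
    (hZ : Measurable Z) (hint : ∀ i, Integrable (fun a => Z a i) μ)
    (hZ' : Measurable Z') (hint' : ∀ i, Integrable (fun a => Z' a i) μ) (hind : IndepFun Y Z' μ) :
    tauCoeff μ Y Z ≤ 2 * ∫⁻ ω, ENNReal.ofReal (∑ i, |Z ω i - Z' ω i|) ∂μ := by
  set W : Ω → (Fin l → ℝ) × (Fin l → ℝ) := fun ω => (Z ω, Z' ω)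
  have hW : Measurable W := hZ.prodMk hZ'
  set D := ∫⁻ ω, ENNReal.ofReal (∑ i, |Z ω i - Z' ω i|) ∂μ
  -- The conditional law of `(Z, Z')` given `Y` couples the conditional law of `Z` with that of
  -- `Z'`, which by independence is the unconditional one.
  have h1 : ∀ᵐ ω ∂μ, condDistrib Z Y μ (Y ω) = (condDistrib W Y μ (Y ω)).map Prod.fst := by
    have := ae_of_ae_map
      hY.aemeasurable
      (condDistrib_comp (μ := μ) Y hW.aemeasurable (measurable_fst (α := Fin l → ℝ) (β := Fin l → ℝ)))
    filter_upwards [this] with ω hω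
    rw [← Kernel.map_apply _ measurable_fst, ← hω]
    rfl
  have h2 : ∀ᵐ ω ∂μ, μ.map Z' = (condDistrib W Y μ (Y ω)).map Prod.snd := by
    have : IsProbabilityMeasure (μ.map Z') := Measure.isProbabilityMeasure_map hZ'.aemeasurable
    have := ae_of_ae_map
      hY.aemeasurable
      (condDistrib_comp (μ := μ) Y hW.aemeasurable (measurable_snd (α := Fin l → ℝ) (β := Fin l → ℝ)))
    have h3 : condDistrib Z' Y μ =ᵐ[μ.map Y] Kernel.const β (μ.map Z') := by
      refine condDistrib_ae_eq_of_measure_eq_compProd Y hZ'.aemeasurable ?_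
      rw [Measure.compProd_const]
      exact (indepFun_iff_map_prod_eq_prod_map_map hY.aemeasurable hZ'.aemeasurable).1 hind
    filter_upwards [this, ae_of_ae_map hY.aemeasurable h3] with ω hω hω'
    rw [← Kernel.map_apply _ measurable_snd, ← hω]
    exact hω'.symm
  have hi1 : ∀ᵐ ω ∂μ, ∀ i, Integrable (fun w => w.1 i) (condDistrib W Y μ (Y ω)) := by
    rw [ae_all_iff]
    intro i
    refine Integrable.condDistrib_ae (μ := μ) (f := fun x : β × (Fin l → ℝ) × (Fin l → ℝ) => x.2.1 i)
      hY.aemeasurable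
      hW.aemeasurable ?_
    rw [integrable_map_measure (by fun_prop) (hY.prodMk hW).aemeasurable]
    exact hint i
  have hi2 : ∀ᵐ ω ∂μ, ∀ i, Integrable (fun w => w.2 i) (condDistrib W Y μ (Y ω)) := by
    rw [ae_all_iff]
    intro i
    refine Integrable.condDistrib_ae (μ := μ) (f := fun x : β × (Fin l → ℝ) × (Fin l → ℝ) => x.2.2 i)
      hY.aemeasurable
      hW.aemeasurable ?_
    rw [integrable_map_measure (by fun_prop) (hY.prodMk hW).aemeasurable]
    exact hint' i
  have hcost : Measurable fun w : (Fin l → ℝ) × (Fin l → ℝ) =>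
      ENNReal.ofReal (∑ i, |w.1 i - w.2 i|) := by fun_prop
  have hbound : ∀ᵐ ω ∂μ, (⨆ (f : (Fin l → ℝ) → ℝ) (_ : IsL1Lipschitz f),
      ENNReal.ofReal |(∫ z, f z ∂(condDistrib Z Y μ (Y ω))) - ∫ ω', f (Z ω') ∂μ|)
      ≤ ∫⁻ w, ENNReal.ofReal (∑ i, |w.1 i - w.2 i|) ∂(condDistrib W Y μ (Y ω)) + D := by
    -- The null set is fixed before `f`, as the supremum is over an uncountable family.
    filter_upwards [h1, h2, hi1, hi2] with ω e1 e2 i1 i2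
    refine iSup₂_le fun f hf => ?_
    have hfm : ∀ κ : Measure (Fin l → ℝ), AEStronglyMeasurable f κ := fun κ =>
      hf.continuous.aestronglyMeasurable
    have k1 := hf.ofReal_abs_integral_sub_le measurable_fst i1 measurable_snd i2
    have k2 := hf.ofReal_abs_integral_sub_le hZ hint hZ' hint'
    rw [e1, integral_map measurable_fst.aemeasurable (hfm _)]
    have e3 : ∫ w, f w.2 ∂(condDistrib W Y μ (Y ω)) = ∫ ω, f (Z' ω) ∂μ := by
      rw [← integral_map measurable_snd.aemeasurable (hfm _), ← e2,
        integral_map hZ'.aemeasurable (hfm _)]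
    rw [e3] at k1
    -- Triangle inequality through the integral of `f (Z')`: one leg costs the conditional coupling,
    -- the other the unconditional one, whence the factor 2 after averaging.
    refine le_trans ?_ (add_le_add k1 k2)
    rw [← ENNReal.ofReal_add (abs_nonneg _) (abs_nonneg _)]
    refine ENNReal.ofReal_le_ofReal ?_
    rw [abs_sub_comm (∫ a, f (Z a) ∂μ)]
    exact abs_sub_le _ _ _
  calc tauCoeff μ Y Z
      ≤ ∫⁻ ω, (∫⁻ w, ENNReal.ofReal (∑ i, |w.1 i - w.2 i|) ∂(condDistrib W Y μ (Y ω)) + D) ∂μ :=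
        lintegral_mono_ae hbound
    _ = D + D := by
        rw [lintegral_add_right _ measurable_const, lintegral_const, measure_univ, mul_one]
        congr 1
        have hk : Measurable fun y => ∫⁻ w, ENNReal.ofReal (∑ i, |w.1 i - w.2 i|)
            ∂(condDistrib W Y μ y) := hcost.lintegral_kernel
        rw [← lintegral_map hk hY, ← Measure.lintegral_compProd (μ := μ.map Y)
          (κ := condDistrib W Y μ) (f := fun x => ENNReal.ofReal (∑ i, |x.2.1 i - x.2.2 i|))
          (hcost.comp measurable_snd), compProd_map_condDistrib hW.aemeasurable,
          lintegral_map (f := fun x : β × (Fin l → ℝ) × (Fin l → ℝ) =>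
            ENNReal.ofReal (∑ i, |x.2.1 i - x.2.2 i|)) (hcost.comp measurable_snd) (hY.prodMk hW)]
    _ = 2 * D := (two_mul D).symm

end Tau

end CountMEM

namespace CountMEM

/-! ### Randomly rounded counts and binomial thinning. -/

section Thinning

/-- An innovation together with a sequence of uniform variables. -/
abbrev Innov : Type := ℕ × (ℕ → unitInterval)

/-- The law of an innovation of law `ν` with an independent sequence of i.i.d. uniform variables. -/
noncomputable def innovLaw (ν : Measure ℕ) : Measure Innov :=
  ν.prod (Measure.infinitePi fun _ : ℕ => (volume : Measure unitInterval))

instance (ν : Measure ℕ) [IsProbabilityMeasure ν] : IsProbabilityMeasure (innovLaw ν) := by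
  unfold innovLaw
  infer_instance

/-- The count with conditional mean `m` and innovation `x.1`, as a randomly rounded sum. -/
noncomputable def count (m : ℝ) (x : Innov) : ℕ := ∑ k ∈ Finset.range x.1, ⌈m - x.2 k⌉₊

/-- The number of uniform variables below `f` among the first `x.1`. -/
noncomputable def thin (f : ℝ) (n : ℕ) (u : ℕ → unitInterval) : ℕ :=
  ∑ k ∈ Finset.range n, if (u k : ℝ) < f then 1 else 0

lemma count_def (m : ℝ) (x : Innov) : count m x = ∑ k ∈ Finset.range x.1, ⌈m - x.2 k⌉₊ := rfl

lemma thin_def (f : ℝ) (n : ℕ) (u : ℕ → unitInterval) :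
    thin f n u = ∑ k ∈ Finset.range n, if (u k : ℝ) < f then 1 else 0 := rfl

/-- The same uniforms serve every `m`. The thinning part alone is not monotone: it drops when `m`
crosses an integer, and the floor part compensates. -/
lemma count_mono (x : Innov) : Monotone fun m => count m x := fun _ _ h =>
  Finset.sum_le_sum fun _ _ => Nat.ceil_mono (sub_le_sub_right h _)

/-- The ceiling is left-continuous and integer-valued, so along a limit from below it stabilizes. -/
lemma eventually_natCeil_eq {c : ℝ} {s : ℕ → ℝ} (hs : Tendsto s atTop (𝓝 c)) (hle : ∀ n, s n ≤ c) :
    ∀ᶠ n in atTop, ⌈s n⌉₊ = ⌈c⌉₊ := by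
  rcases Nat.eq_zero_or_pos ⌈c⌉₊ with h | h
  · exact Eventually.of_forall fun n => by
      rw [h, Nat.ceil_eq_zero]
      exact (hle n).trans (Nat.ceil_eq_zero.1 h)
  · have h1 : ((⌈c⌉₊ - 1 : ℕ) : ℝ) < c := Nat.lt_ceil.1 (Nat.sub_lt h one_pos)
    filter_upwards [hs.eventually_const_lt h1] with n hn
    have h2 := Nat.lt_ceil.2 hn
    have h3 := Nat.ceil_mono (hle n)
    omega

lemma eventually_count_eq {c : ℝ} {s : ℕ → ℝ} (hs : Tendsto s atTop (𝓝 c)) (hle : ∀ n, s n ≤ c)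
    (x : Innov) : ∀ᶠ n in atTop, count (s n) x = count c x := by
  have h : ∀ᶠ n in atTop, ∀ k ∈ Finset.range x.1, ⌈s n - x.2 k⌉₊ = ⌈c - x.2 k⌉₊ :=
    (Filter.eventually_all_finset _).2 fun k _ =>
      eventually_natCeil_eq (hs.sub_const _) fun n => sub_le_sub_right (hle n) _
  filter_upwards [h] with n hn
  exact Finset.sum_congr rfl hn

/-- `m - u` lies in `(⌊m⌋, ⌊m⌋ + 1]` if `u` is below the fractional part and in `(⌊m⌋ - 1, ⌊m⌋]`
otherwise. The value `u = 1` would break the second case for integers `m ≥ 1`. -/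
lemma natCeil_sub_eq {m u : ℝ} (hm : 0 ≤ m) (hu0 : 0 ≤ u) (hu1 : u < 1) :
    ⌈m - u⌉₊ = ⌊m⌋₊ + if u < Int.fract m then 1 else 0 := by
  have hfl : (⌊m⌋₊ : ℝ) + Int.fract m = m := by
    rw [natCast_floor_eq_intCast_floor hm]
    exact Int.floor_add_fract m
  have hf1 := Int.fract_lt_one m
  have hf0 := Int.fract_nonneg m
  split_ifs with h
  · rw [Nat.ceil_eq_iff (by omega)]
    push_cast
    constructor <;> linarith
  · rcases Nat.eq_zero_or_pos ⌊m⌋₊ with h0 | h0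
    · rw [h0, Nat.ceil_eq_zero]
      rw [h0] at hfl
      push_cast at hfl
      linarith
    · rw [add_zero, Nat.ceil_eq_iff h0.ne', Nat.cast_sub h0]
      push_cast
      constructor <;> linarith

lemma count_eq_floor_add_thin {m : ℝ} (hm : 0 ≤ m) {x : Innov} (hx : ∀ k, (x.2 k : ℝ) < 1) :
    count m x = ⌊m⌋₊ * x.1 + thin (Int.fract m) x.1 x.2 := by
  unfold count thin
  rw [Finset.sum_congr rfl fun k _ => natCeil_sub_eq hm (x.2 k).2.1 (hx k),
    Finset.sum_add_distrib, Finset.sum_const, Finset.card_range, smul_eq_mul, mul_comm]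

lemma ae_unitInterval_lt_one : ∀ᵐ u : unitInterval, (u : ℝ) < 1 := by
  have h : volume (Set.Iio (1 : unitInterval)) = 1 := by simp [unitInterval.volume_Iio]
  have h2 := (mem_ae_iff_prob_eq_one measurableSet_Iio).2 h
  filter_upwards [h2] with u hu
  exact hu

lemma ae_innovLaw_lt_one (ν : Measure ℕ) [IsProbabilityMeasure ν] :
    ∀ᵐ x ∂(innovLaw ν), ∀ k, (x.2 k : ℝ) < 1 := by
  rw [ae_all_iff]
  intro k
  have h : MeasurePreserving (fun x : Innov => x.2 k) (innovLaw ν) volume :=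
    (measurePreserving_eval_infinitePi (fun _ : ℕ => (volume : Measure unitInterval)) k).comp
      measurePreserving_snd
  exact h.quasiMeasurePreserving.ae ae_unitInterval_lt_one

attribute [irreducible] count thin

lemma measurable_count : Measurable fun y : ℝ × Innov => count y.1 y.2 := by
  have h : Measurable fun z : ℕ × (ℝ × (ℕ → unitInterval)) => count z.2.1 (z.1, z.2.2) := by
    refine measurable_from_prod_countable_right fun n => ?_
    simp only [count_def]
    refine Finset.measurable_fun_sum _ fun k _ => Nat.measurable_ceil.comp ?_
    fun_prop
  have h2 : Measurable fun y : ℝ × Innov => (y.2.1, (y.1, y.2.2)) := by fun_prop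
  exact h.comp h2

lemma measurable_thin :
    Measurable fun y : (ℝ × ℕ) × (ℕ → unitInterval) => thin y.1.1 y.1.2 y.2 := by
  have h : Measurable fun z : ℕ × (ℝ × (ℕ → unitInterval)) => thin z.2.1 z.1 z.2.2 := by
    refine measurable_from_prod_countable_right fun n => ?_
    simp only [thin_def]
    refine Finset.measurable_fun_sum _ fun k _ => Measurable.ite ?_ measurable_const
      measurable_const
    exact measurableSet_lt (by fun_prop) (by fun_prop)
  exact h.comp (measurable_fst.snd.prodMk (measurable_fst.fst.prodMk measurable_snd))

/-- Random rounding is unbiased: floor plus the probability that a uniform falls below the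
fractional part. -/
lemma lintegral_natCeil_sub {m : ℝ} (hm : 0 ≤ m) :
    ∫⁻ u : unitInterval, (⌈m - u⌉₊ : ℝ≥0∞) = ENNReal.ofReal m := by
  have h : ∀ᵐ u : unitInterval, (⌈m - u⌉₊ : ℝ≥0∞)
      = (⌊m⌋₊ : ℝ≥0∞) + (Set.Iio (fracPart m)).indicator 1 u := by
    filter_upwards [ae_unitInterval_lt_one] with u hu
    rw [natCeil_sub_eq hm u.2.1 hu]
    push_cast
    congr 1
  rw [lintegral_congr_ae h, lintegral_add_left measurable_const, lintegral_indicator_one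
    measurableSet_Iio, unitInterval.volume_Iio, lintegral_const, measure_univ, mul_one,
    ← ENNReal.ofReal_natCast, ← ENNReal.ofReal_add (Nat.cast_nonneg _) (fracPart m).2.1]
  congr 1
  rw [natCast_floor_eq_intCast_floor hm]
  exact Int.floor_add_fract m

lemma lintegral_count {ν : Measure ℕ} [IsProbabilityMeasure ν]
    (hν : ∫⁻ n, (n : ℝ≥0∞) ∂ν = 1) {m : ℝ} (hm : 0 ≤ m) :
    ∫⁻ x, (count m x : ℝ≥0∞) ∂(innovLaw ν) = ENNReal.ofReal m := by
  have hmeas : Measurable fun x : Innov => (count m x : ℝ≥0∞) :=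
by
    have h1 : Measurable fun x : Innov => (m, x) := by fun_prop
    have h2 : Measurable fun x : Innov => count m x := measurable_count.comp h1
    exact (measurable_of_countable (fun n : ℕ => (n : ℝ≥0∞))).comp h2
  rw [innovLaw, lintegral_prod _ hmeas.aemeasurable]
  have h (n : ℕ) : ∫⁻ u, (count m (n, u) : ℝ≥0∞)
      ∂(Measure.infinitePi fun _ : ℕ => (volume : Measure unitInterval))
      = n * ENNReal.ofReal m := by
    have hg : Measurable fun v : unitInterval => (⌈m - v⌉₊ : ℝ≥0∞) :=
      (measurable_of_countable (fun n : ℕ => (n : ℝ≥0∞))).comp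
        (Nat.measurable_ceil.comp (by fun_prop))
    simp only [count_def, Nat.cast_sum]
    have hgk (k : ℕ) : Measurable fun u : ℕ → unitInterval => (⌈m - u k⌉₊ : ℝ≥0∞) :=
      hg.comp (measurable_pi_apply k)
    rw [lintegral_finsetSum _ fun k _ => hgk k]
    have hk (k : ℕ) : ∫⁻ u : ℕ → unitInterval, (⌈m - u k⌉₊ : ℝ≥0∞)
        ∂(Measure.infinitePi fun _ : ℕ => (volume : Measure unitInterval)) = ENNReal.ofReal m := by
      rw [← lintegral_natCeil_sub hm]
      exact (measurePreserving_eval_infinitePi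
        (fun _ : ℕ => (volume : Measure unitInterval)) k).lintegral_comp hg
    simp [hk]
  simp_rw [h]
  rw [lintegral_mul_const _ (measurable_of_countable _), hν, one_mul]

/-- The right side is the coordinate law appearing in `setBernoulli_eq_map`; with `Q` the
proposition `k < n`, it expresses each trial through a uniform variable. -/
lemma map_lt_and (f : unitInterval) (Q : Prop) : (volume : Measure unitInterval).map
    (fun v : unitInterval => (v < f ∧ Q : Prop))
    = unitInterval.toNNReal f • Measure.dirac Q
      + unitInterval.toNNReal (unitInterval.symm f) • Measure.dirac False := by
  have hg : Measurable fun v : unitInterval => (v < f ∧ Q : Prop) :=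
    measurableSet_setOfPred.1 (measurableSet_Iio.inter (MeasurableSet.const Q))
  ext S hS
  rw [Measure.map_apply hg hS]
  classical
  have hpre : (fun v : unitInterval => (v < f ∧ Q : Prop)) ⁻¹' S
      = (if Q ∈ S then Set.Iio f else ∅)
        ∪ (if False ∈ S then Set.Ici f else ∅) := by
    ext v
    by_cases hv : v < f
    · have hv' : ¬ f ≤ v := not_le.2 hv
      have hq : (v < f ∧ Q) = Q := by simp [hv]
      rw [Set.mem_preimage, hq, Set.mem_union]
      split_ifs <;> simp [*]
    · have hv' : f ≤ v := not_lt.1 hv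
      have hq : (v < f ∧ Q) = False := by simp [hv]
      rw [Set.mem_preimage, hq, Set.mem_union]
      split_ifs <;> simp [*]
  have hdisj : Disjoint (if Q ∈ S then Set.Iio f else ∅)
      (if False ∈ S then Set.Ici f else ∅) := by
    split_ifs <;> simp [Set.disjoint_left]
  rw [hpre, measure_union hdisj (by split_ifs <;> measurability)]
  simp only [Measure.add_apply, Measure.smul_apply, Measure.dirac_apply' _ hS]
  have e1 : (unitInterval.toNNReal f : ℝ≥0∞) = ENNReal.ofReal f :=
    (ENNReal.ofReal_eq_coe_nnreal f.2.1).symm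
  have e2 : (unitInterval.toNNReal (unitInterval.symm f) : ℝ≥0∞) = ENNReal.ofReal (1 - f) :=
    (ENNReal.ofReal_eq_coe_nnreal (unitInterval.symm f).2.1).symm
  congr 1
  · split_ifs with h
    · simp [h, unitInterval.volume_Iio, e1, ENNReal.smul_def]
    · simp [h]
  · split_ifs with h
    · simp [h, unitInterval.volume_Ici, e2, ENNReal.smul_def]
    · simp [h]

/-- The number of successes among `n` independent trials is binomial. -/
lemma map_thin (n : ℕ) (f : unitInterval) :
    (Measure.infinitePi fun _ : ℕ => (volume : Measure unitInterval)).map (thin f n)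
      = binomial n f := by
  have hg (k : ℕ) : Measurable fun v : unitInterval => (v < f ∧ k ∈ Set.Iio n : Prop) :=
    measurableSet_setOfPred.1 (measurableSet_Iio.inter (MeasurableSet.const (k ∈ Set.Iio n)))
  have hpi : Measurable fun (u : ℕ → unitInterval) (k : ℕ) => (u k < f ∧ k ∈ Set.Iio n : Prop) :=
    measurable_pi_lambda _ fun k => (hg k).comp (measurable_pi_apply k)
  have hset : Measurable fun r : ℕ → Prop => {i | r i} := MeasurableEquiv.setOfPred.measurable
  rw [binomial, setBernoulli_eq_map]
  simp_rw [← map_lt_and]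
  -- The product of the trial laws is the image of the product of uniform laws, so only an equality
  -- of counting maps remains.
  rw [← Measure.infinitePi_map_pi _ hg, Measure.map_map hset hpi,
    Measure.map_map (by fun_prop) (hset.comp hpi)]
  congr 1
  ext u
  simp only [thin_def, Function.comp_apply]
  rw [Finset.sum_boole, Nat.cast_id, ← Set.ncard_coe_finset]
  congr 1
  ext k
  simp [and_comm]

end Thinning

end CountMEM

namespace CountMEM

/-! ### The linear mean recursion. -/

section LinearMean

variable {p q : ℕ} (a₀ : ℝ) (a : Fin p → ℝ) (b : Fin q → ℝ)

/-- The linear conditional mean at time `t`. -/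
def linMean (x m : ℤ → ℝ) (t : ℤ) : ℝ :=
  a₀ + ∑ i : Fin p, a i * x (t - ((i : ℤ) + 1)) + ∑ j : Fin q, b j * m (t - ((j : ℤ) + 1))

variable {a₀ a b}

lemma linMean_mono (ha : ∀ i, 0 ≤ a i) (hb : ∀ j, 0 ≤ b j) {x x' m m' : ℤ → ℝ}
    (hx : ∀ s, x s ≤ x' s) (hm : ∀ s, m s ≤ m' s) (t : ℤ) :
    linMean a₀ a b x m t ≤ linMean a₀ a b x' m' t :=
  add_le_add (add_le_add_right (Finset.sum_le_sum fun i _ =>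
    mul_le_mul_of_nonneg_left (hx _) (ha i)) _)
    (Finset.sum_le_sum fun j _ => mul_le_mul_of_nonneg_left (hm _) (hb j))

lemma le_linMean (ha : ∀ i, 0 ≤ a i) (hb : ∀ j, 0 ≤ b j) {x m : ℤ → ℝ}
    (hx : ∀ s, 0 ≤ x s) (hm : ∀ s, 0 ≤ m s) (t : ℤ) : a₀ ≤ linMean a₀ a b x m t := by
  have h := linMean_mono (a₀ := a₀) ha hb hx hm t
  simpa [linMean] using h

lemma tendsto_linMean {x m : ℤ → ℝ} {xs ms : ℕ → ℤ → ℝ}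
    (hx : ∀ s, Tendsto (fun n => xs n s) atTop (𝓝 (x s)))
    (hm : ∀ s, Tendsto (fun n => ms n s) atTop (𝓝 (m s))) (t : ℤ) :
    Tendsto (fun n => linMean a₀ a b (xs n) (ms n) t) atTop (𝓝 (linMean a₀ a b x m t)) :=
  (tendsto_const_nhds.add (tendsto_finsetSum _ fun i _ => (hx _).const_mul (a i))).add
    (tendsto_finsetSum _ fun j _ => (hm _).const_mul (b j))

lemma measurable_linMean {Ω : Type*} {m₀ : MeasurableSpace Ω} {x m : ℤ → Ω → ℝ} {t : ℤ}
    (hx : ∀ i : Fin p, Measurable (x (t - ((i : ℤ) + 1))))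
    (hm : ∀ j : Fin q, Measurable (m (t - ((j : ℤ) + 1)))) :
    Measurable fun ω => linMean a₀ a b (fun s => x s ω) (fun s => m s ω) t :=
  (measurable_const.add (Finset.measurable_fun_sum _ fun i _ => (hx i).const_mul (a i))).add
    (Finset.measurable_fun_sum _ fun j _ => (hm j).const_mul (b j))

/-- Counts and means share the expectation `c`, so only the total coefficient sum enters. -/
lemma lintegral_linMean {Ω : Type*} {m₀ : MeasurableSpace Ω} {μ : Measure Ω}
    [IsProbabilityMeasure μ] (ha₀ : 0 ≤ a₀) (ha : ∀ i, 0 ≤ a i) (hb : ∀ j, 0 ≤ b j)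
    {x m : ℤ → Ω → ℝ} (hx : ∀ s, Measurable (x s)) (hm : ∀ s, Measurable (m s))
    (hx0 : ∀ s ω, 0 ≤ x s ω) (hm0 : ∀ s ω, 0 ≤ m s ω) {c : ℝ} (hc : 0 ≤ c)
    (hxc : ∀ s, ∫⁻ ω, ENNReal.ofReal (x s ω) ∂μ = ENNReal.ofReal c)
    (hmc : ∀ s, ∫⁻ ω, ENNReal.ofReal (m s ω) ∂μ = ENNReal.ofReal c) (t : ℤ) :
    ∫⁻ ω, ENNReal.ofReal (linMean a₀ a b (fun s => x s ω) (fun s => m s ω) t) ∂μ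
      = ENNReal.ofReal (a₀ + (∑ i, a i + ∑ j, b j) * c) := by
  have hA (ω : Ω) (i : Fin p) : 0 ≤ a i * x (t - ((i : ℤ) + 1)) ω := mul_nonneg (ha i) (hx0 _ _)
  have hB (ω : Ω) (j : Fin q) : 0 ≤ b j * m (t - ((j : ℤ) + 1)) ω := mul_nonneg (hb j) (hm0 _ _)
  have hsplit (ω : Ω) : ENNReal.ofReal (linMean a₀ a b (fun s => x s ω) (fun s => m s ω) t)
      = ENNReal.ofReal a₀
        + ∑ i : Fin p, ENNReal.ofReal (a i) * ENNReal.ofReal (x (t - ((i : ℤ) + 1)) ω)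
        + ∑ j : Fin q, ENNReal.ofReal (b j) * ENNReal.ofReal (m (t - ((j : ℤ) + 1)) ω) := by
    rw [linMean, ENNReal.ofReal_add (add_nonneg ha₀ (Finset.sum_nonneg fun i _ => hA ω i))
      (Finset.sum_nonneg fun j _ => hB ω j),
      ENNReal.ofReal_add ha₀ (Finset.sum_nonneg fun i _ => hA ω i),
      ENNReal.ofReal_sum_of_nonneg fun i _ => hA ω i,
      ENNReal.ofReal_sum_of_nonneg fun j _ => hB ω j]
    simp_rw [ENNReal.ofReal_mul (ha _), ENNReal.ofReal_mul (hb _)]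
  have mA (i : Fin p) : Measurable fun ω =>
      ENNReal.ofReal (a i) * ENNReal.ofReal (x (t - ((i : ℤ) + 1)) ω) :=
    (hx _).ennreal_ofReal.const_mul _
  have mB (j : Fin q) : Measurable fun ω =>
      ENNReal.ofReal (b j) * ENNReal.ofReal (m (t - ((j : ℤ) + 1)) ω) :=
    (hm _).ennreal_ofReal.const_mul _
  simp_rw [hsplit]
  rw [lintegral_add_right _ (Finset.measurable_fun_sum _ fun j _ => mB j),
    lintegral_add_right _ (Finset.measurable_fun_sum _ fun i _ => mA i),
    lintegral_finsetSum _ fun i _ => mA i, lintegral_finsetSum _ fun j _ => mB j]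
  simp_rw [lintegral_const_mul _ (hx _).ennreal_ofReal, lintegral_const_mul _ (hm _).ennreal_ofReal,
    hxc, hmc, ← ENNReal.ofReal_mul (ha _), ← ENNReal.ofReal_mul (hb _)]
  rw [lintegral_const, measure_univ, mul_one,
    ← ENNReal.ofReal_sum_of_nonneg fun i _ => mul_nonneg (ha i) hc,
    ← ENNReal.ofReal_sum_of_nonneg fun j _ => mul_nonneg (hb j) hc,
    ← ENNReal.ofReal_add ha₀ (Finset.sum_nonneg fun i _ => mul_nonneg (ha i) hc),
    ← ENNReal.ofReal_add (add_nonneg ha₀ (Finset.sum_nonneg fun i _ => mul_nonneg (ha i) hc))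
      (Finset.sum_nonneg fun j _ => mul_nonneg (hb j) hc), ← Finset.sum_mul, ← Finset.sum_mul]
  congr 1
  ring

end LinearMean

/-! ### Construction of the solution by monotone Picard iteration. -/

section PicardIteration

variable {p q : ℕ} (a₀ : ℝ) (a : Fin p → ℝ) (b : Fin q → ℝ)

/-- The law of the two-sided sequence of innovations. -/
noncomputable def procLaw (ν : Measure ℕ) [IsProbabilityMeasure ν] : Measure (ℤ → Innov) :=
  Measure.infinitePi fun _ => innovLaw ν

instance (ν : Measure ℕ) [IsProbabilityMeasure ν] : IsProbabilityMeasure (procLaw ν) := by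
  unfold procLaw
  infer_instance

/-- Picard iterates of the conditional mean process, started from `0`. -/
noncomputable def approxMean : ℕ → ℤ → (ℤ → Innov) → ℝ
  | 0 => fun _ _ => 0
  | n + 1 => fun t ω =>
    linMean a₀ a b (fun s => count (approxMean n s ω) (ω s)) (fun s => approxMean n s ω) t

/-- The count process of the Picard iterates. -/
noncomputable def approxCount (n : ℕ) (t : ℤ) (ω : ℤ → Innov) : ℕ :=
  count (approxMean a₀ a b n t ω) (ω t)

/-- The conditional mean process, as the supremum of the Picard iterates. -/
noncomputable def meanProc (t : ℤ) (ω : ℤ → Innov) : ℝ :=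
  (⨆ n, ENNReal.ofReal (approxMean a₀ a b n t ω)).toReal

/-- The count process. -/
noncomputable def countProc (t : ℤ) (ω : ℤ → Innov) : ℕ :=
  count (meanProc a₀ a b t ω) (ω t)

lemma approxMean_succ (n : ℕ) (t : ℤ) (ω : ℤ → Innov) :
    approxMean a₀ a b (n + 1) t ω = linMean a₀ a b (fun s => (approxCount a₀ a b n s ω : ℝ))
      (fun s => approxMean a₀ a b n s ω) t := rfl

lemma approxMean_shift (n : ℕ) (t : ℤ) (ω : ℤ → Innov) :
    approxMean a₀ a b n t (shift ω) = approxMean a₀ a b n (t + 1) ω := by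
  induction n generalizing t with
  | zero => rfl
  | succ n ih =>
    simp only [approxMean_succ, linMean, approxCount, ih, shift]
    have h (k : ℤ) : t - k + 1 = t + 1 - k := by ring
    simp_rw [h]

lemma countProc_shift (t : ℤ) (ω : ℤ → Innov) :
    countProc a₀ a b t (shift ω) = countProc a₀ a b (t + 1) ω := by
  simp only [countProc, meanProc, approxMean_shift, shift]

lemma measurable_count_coord {I : Set ℤ} {A : (ℤ → Innov) → ℝ} (hA : Measurable[coordSigma Innov I] A)
    {t : ℤ} (ht : t ∈ I) : Measurable[coordSigma Innov I] fun ω => count (A ω) (ω t) :=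
  measurable_count.comp (hA.prodMk (measurable_coord ht))

lemma measurable_natCast_real {Ω : Type*} {m : MeasurableSpace Ω} {f : Ω → ℕ} (hf : Measurable f) :
    Measurable fun ω => (f ω : ℝ) :=
  (measurable_of_countable (fun n : ℕ => (n : ℝ))).comp hf

/-- Each iteration looks back at most `max p q ≤ p + q` steps. Excluding `t` itself makes the mean
independent of the innovation at `t`. -/
lemma measurable_approxMean (n : ℕ) (t : ℤ) :
    Measurable[coordSigma Innov (Set.Ico (t - n * (p + q)) t)] (approxMean a₀ a b n t) := by
  induction n generalizing t with
  | zero => exact measurable_const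
  | succ n ih =>
    have hsub (k : ℤ) (h0 : 0 ≤ k) (hk : k < p + q) :
        coordSigma Innov (Set.Ico (t - (k + 1) - n * (p + q)) (t - (k + 1)))
          ≤ coordSigma Innov (Set.Ico (t - (n + 1 : ℕ) * (p + q)) t) := by
      refine coordSigma_mono (Set.Ico_subset_Ico ?_ (by omega))
      push_cast
      linarith
    have hmem (k : ℤ) (h0 : 0 ≤ k) (hk : k < p + q) :
        t - (k + 1) ∈ Set.Ico (t - (n + 1 : ℕ) * (p + q : ℤ)) t := by
      refine ⟨?_, by omega⟩
      have : 0 ≤ (n : ℤ) * (p + q) := by positivity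
      push_cast
      linarith
    have hm (k : ℤ) (h0 : 0 ≤ k) (hk : k < p + q) :
        Measurable[coordSigma Innov (Set.Ico (t - (n + 1 : ℕ) * (p + q)) t)]
          (approxMean a₀ a b n (t - (k + 1))) := (ih _).mono (hsub k h0 hk) le_rfl
    exact measurable_linMean (x := fun s ω => (approxCount a₀ a b n s ω : ℝ))
      (fun i : Fin p => measurable_natCast_real
        (measurable_count_coord (hm i (by omega) (by omega)) (hmem i (by omega) (by omega))))
      (fun j : Fin q => hm j (by omega) (by omega))

lemma measurable_approxCount (n : ℕ) (t : ℤ) :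
    Measurable[coordSigma Innov (Set.Icc (t - n * (p + q)) t)] (approxCount a₀ a b n t) := by
  have h : 0 ≤ (n : ℤ) * (p + q) := by positivity
  exact measurable_count_coord
    ((measurable_approxMean a₀ a b n t).mono (coordSigma_mono Set.Ico_subset_Icc_self) le_rfl)
    ⟨by linarith, le_rfl⟩

lemma measurable_meanProc (t : ℤ) :
    Measurable[coordSigma Innov (Set.Iio t)] (meanProc a₀ a b t) := by
  have h (n : ℕ) : Measurable[coordSigma Innov (Set.Iio t)] fun ω =>
      ENNReal.ofReal (approxMean a₀ a b n t ω) :=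
    ((measurable_approxMean a₀ a b n t).mono (coordSigma_mono fun _ h => h.2)
      le_rfl).ennreal_ofReal
  exact (Measurable.iSup h).ennreal_toReal

lemma measurable_countProc (t : ℤ) :
    Measurable[coordSigma Innov (Set.Iic t)] (countProc a₀ a b t) := by
  have h : Measurable[coordSigma Innov (Set.Iic t)] (meanProc a₀ a b t) :=
    (measurable_meanProc a₀ a b t).mono (coordSigma_mono Set.Iio_subset_Iic_self) le_rfl
  exact measurable_count_coord h (Set.mem_Iic.2 le_rfl)

variable {a₀ a b}

lemma approxMean_nonneg (ha₀ : 0 < a₀) (ha : ∀ i, 0 ≤ a i) (hb : ∀ j, 0 ≤ b j) (n : ℕ) (t : ℤ)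
    (ω : ℤ → Innov) : 0 ≤ approxMean a₀ a b n t ω := by
  induction n generalizing t with
  | zero => exact le_rfl
  | succ n ih =>
    rw [approxMean_succ]
    exact ha₀.le.trans (le_linMean ha hb (fun s => Nat.cast_nonneg _) ih t)

/-- Starting from 0 makes the first step upward, and the recursion is order preserving. -/
lemma approxMean_mono (ha₀ : 0 < a₀) (ha : ∀ i, 0 ≤ a i) (hb : ∀ j, 0 ≤ b j) (t : ℤ)
    (ω : ℤ → Innov) : Monotone fun n => approxMean a₀ a b n t ω := by
  refine monotone_nat_of_le_succ fun n => ?_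
  induction n generalizing t with
  | zero => exact approxMean_nonneg ha₀ ha hb 1 t ω
  | succ n ih =>
    exact linMean_mono ha hb (fun s => Nat.cast_le.2 (count_mono _ (ih s))) ih t

/-- A mean depending on the strict past is independent of `ω t`, so Fubini reduces to a
deterministic mean. -/
lemma lintegral_count_coord {ν : Measure ℕ} [IsProbabilityMeasure ν]
    (hν : ∫⁻ n, (n : ℝ≥0∞) ∂ν = 1) {t : ℤ} {A : (ℤ → Innov) → ℝ}
    (hA : Measurable[coordSigma Innov (Set.Iio t)] A) (hA0 : ∀ ω, 0 ≤ A ω) :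
    ∫⁻ ω, (count (A ω) (ω t) : ℝ≥0∞) ∂(procLaw ν) = ∫⁻ ω, ENNReal.ofReal (A ω) ∂(procLaw ν) := by
  have hA' : Measurable A := hA.mono (coordSigma_le _) le_rfl
  have ht : Measurable fun ω : ℤ → Innov => ω t := measurable_pi_apply t
  have hdisj : Disjoint (Set.Iio t) {t} := by simp
  have hind : IndepFun A (fun ω : ℤ → Innov => ω t) (procLaw ν) := by
    rw [IndepFun_iff_Indep]
    exact indep_of_indep_of_le_left (indep_of_indep_of_le_right
      (indep_coordSigma (innovLaw ν) hdisj) (measurable_coord (Set.mem_singleton t)).comap_le)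
      hA.comap_le
  have hlaw : (procLaw ν).map (fun ω : ℤ → Innov => ω t) = innovLaw ν :=
    Measure.infinitePi_map_eval _ t
  have hprod := (indepFun_iff_map_prod_eq_prod_map_map hA'.aemeasurable ht.aemeasurable).1 hind
  have hc : Measurable fun y : ℝ × Innov => (count y.1 y.2 : ℝ≥0∞) :=
    (measurable_of_countable (fun n : ℕ => (n : ℝ≥0∞))).comp measurable_count
  have : IsProbabilityMeasure ((procLaw ν).map A) :=
    Measure.isProbabilityMeasure_map hA'.aemeasurable
  have h1 := lintegral_map (μ := procLaw ν) hc (hA'.prodMk ht)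
  rw [← h1, hprod, hlaw, lintegral_prod _ hc.aemeasurable,
    lintegral_map hc.lintegral_prod_right' hA']
  exact lintegral_congr fun ω => lintegral_count hν (hA0 ω)

variable {ν : Measure ℕ} [IsProbabilityMeasure ν]

lemma lintegral_approxCount (hν : ∫⁻ n, (n : ℝ≥0∞) ∂ν = 1)
    (ha₀ : 0 < a₀) (ha : ∀ i, 0 ≤ a i) (hb : ∀ j, 0 ≤ b j) (n : ℕ) (t : ℤ) :
    ∫⁻ ω, (approxCount a₀ a b n t ω : ℝ≥0∞) ∂(procLaw ν)
      = ∫⁻ ω, ENNReal.ofReal (approxMean a₀ a b n t ω) ∂(procLaw ν) :=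
  lintegral_count_coord hν ((measurable_approxMean a₀ a b n t).mono
    (coordSigma_mono fun _ h => h.2) le_rfl) (approxMean_nonneg ha₀ ha hb n t)

lemma lintegral_countProc (hν : ∫⁻ n, (n : ℝ≥0∞) ∂ν = 1) (t : ℤ) :
    ∫⁻ ω, (countProc a₀ a b t ω : ℝ≥0∞) ∂(procLaw ν)
      = ∫⁻ ω, ENNReal.ofReal (meanProc a₀ a b t ω) ∂(procLaw ν) :=
  lintegral_count_coord hν (measurable_meanProc a₀ a b t) fun _ => ENNReal.toReal_nonneg

lemma lintegral_approxMean (hν : ∫⁻ n, (n : ℝ≥0∞) ∂ν = 1)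
    (ha₀ : 0 < a₀) (ha : ∀ i, 0 ≤ a i) (hb : ∀ j, 0 ≤ b j) (n : ℕ) (t : ℤ) :
    ∫⁻ ω, ENNReal.ofReal (approxMean a₀ a b n t ω) ∂(procLaw ν)
      = ENNReal.ofReal (a₀ * ∑ k ∈ Finset.range n, (∑ i, a i + ∑ j, b j) ^ k) := by
  have hc : 0 ≤ ∑ i, a i + ∑ j, b j :=
    add_nonneg (Finset.sum_nonneg fun i _ => ha i) (Finset.sum_nonneg fun j _ => hb j)
  induction n generalizing t with
  | zero => simp [approxMean]
  | succ n ih =>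
    have hmean (s : ℤ) : Measurable (approxMean a₀ a b n s) :=
      (measurable_approxMean a₀ a b n s).mono (coordSigma_le _) le_rfl
    have hcount (s : ℤ) : Measurable fun ω => (approxCount a₀ a b n s ω : ℝ) :=
      measurable_natCast_real ((measurable_approxCount a₀ a b n s).mono (coordSigma_le _) le_rfl)
    have h := lintegral_linMean (μ := procLaw ν) (x := fun s ω => (approxCount a₀ a b n s ω : ℝ))
      (c := a₀ * ∑ k ∈ Finset.range n, (∑ i, a i + ∑ j, b j) ^ k) ha₀.le ha hb
      hcount hmean (fun _ _ => Nat.cast_nonneg _) (approxMean_nonneg ha₀ ha hb n)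
      (mul_nonneg ha₀.le (Finset.sum_nonneg fun k _ => pow_nonneg hc k))
      (fun s => by
        simp_rw [ENNReal.ofReal_natCast]
        rw [lintegral_approxCount hν ha₀ ha hb, ih])
      ih t
    refine h.trans ?_
    rw [geom_sum_succ]
    congr 1
    ring

/-- The stationary mean. -/
noncomputable def limMean (a₀ : ℝ) (a : Fin p → ℝ) (b : Fin q → ℝ) : ℝ≥0∞ :=
  ⨆ n, ENNReal.ofReal (a₀ * ∑ k ∈ Finset.range n, (∑ i, a i + ∑ j, b j) ^ k)

lemma limMean_ne_top (ha₀ : 0 < a₀) (ha : ∀ i, 0 ≤ a i) (hb : ∀ j, 0 ≤ b j)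
    (hab : ∑ i, a i + ∑ j, b j < 1) : limMean a₀ a b ≠ ∞ := by
  have hc : 0 ≤ ∑ i, a i + ∑ j, b j :=
    add_nonneg (Finset.sum_nonneg fun i _ => ha i) (Finset.sum_nonneg fun j _ => hb j)
  refine ne_top_of_le_ne_top (b := ENNReal.ofReal (a₀ * (1 - (∑ i, a i + ∑ j, b j))⁻¹))
    ENNReal.ofReal_ne_top (iSup_le fun n => ENNReal.ofReal_le_ofReal ?_)
  refine mul_le_mul_of_nonneg_left ?_ ha₀.le
  rw [← tsum_geometric_of_lt_one hc hab]
  exact (summable_geometric_of_lt_one hc hab).sum_le_tsum _ fun k _ => pow_nonneg hc k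

lemma lintegral_iSup_approxMean (hν : ∫⁻ n, (n : ℝ≥0∞) ∂ν = 1)
    (ha₀ : 0 < a₀) (ha : ∀ i, 0 ≤ a i) (hb : ∀ j, 0 ≤ b j) (t : ℤ) :
    ∫⁻ ω, ⨆ n, ENNReal.ofReal (approxMean a₀ a b n t ω) ∂(procLaw ν) = limMean a₀ a b := by
  rw [lintegral_iSup
    (fun n => ((measurable_approxMean a₀ a b n t).mono (coordSigma_le _) le_rfl).ennreal_ofReal)
    fun n m h ω => ENNReal.ofReal_le_ofReal (approxMean_mono ha₀ ha hb t ω h)]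
  simp_rw [lintegral_approxMean hν ha₀ ha hb]
  rfl

/-- One null set serves all times. On it `toReal` may replace an infinite supremum by 0, so the
recursion is only claimed off it. -/
lemma ae_iSup_approxMean_ne_top (hν : ∫⁻ n, (n : ℝ≥0∞) ∂ν = 1)
    (ha₀ : 0 < a₀) (ha : ∀ i, 0 ≤ a i) (hb : ∀ j, 0 ≤ b j) (hab : ∑ i, a i + ∑ j, b j < 1) :
    ∀ᵐ ω ∂(procLaw ν), ∀ t, ⨆ n, ENNReal.ofReal (approxMean a₀ a b n t ω) ≠ ∞ := by
  rw [ae_all_iff]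
  intro t
  have hm : Measurable fun ω => ⨆ n, ENNReal.ofReal (approxMean a₀ a b n t ω) :=
    Measurable.iSup fun n =>
      ((measurable_approxMean a₀ a b n t).mono (coordSigma_le _) le_rfl).ennreal_ofReal
  have h := ae_lt_top (μ := procLaw ν) hm (by
    rw [lintegral_iSup_approxMean hν ha₀ ha hb]
    exact limMean_ne_top ha₀ ha hb hab)
  filter_upwards [h] with ω hω using hω.ne

lemma approxMean_le_meanProc {t : ℤ}
    {ω : ℤ → Innov} (hω : ⨆ n, ENNReal.ofReal (approxMean a₀ a b n t ω) ≠ ∞) (n : ℕ) :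
    approxMean a₀ a b n t ω ≤ meanProc a₀ a b t ω := by
  rw [meanProc, ← ENNReal.ofReal_le_iff_le_toReal hω]
  exact le_iSup (fun n => ENNReal.ofReal (approxMean a₀ a b n t ω)) n

lemma tendsto_approxMean (ha₀ : 0 < a₀) (ha : ∀ i, 0 ≤ a i) (hb : ∀ j, 0 ≤ b j) {t : ℤ}
    {ω : ℤ → Innov} (hω : ⨆ n, ENNReal.ofReal (approxMean a₀ a b n t ω) ≠ ∞) :
    Tendsto (fun n => approxMean a₀ a b n t ω) atTop (𝓝 (meanProc a₀ a b t ω)) := by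
  have h := (ENNReal.tendsto_toReal hω).comp (tendsto_atTop_iSup
    (fun n m h => ENNReal.ofReal_le_ofReal (approxMean_mono ha₀ ha hb t ω h)))
  refine h.congr fun n => ?_
  exact ENNReal.toReal_ofReal (approxMean_nonneg ha₀ ha hb n t ω)

lemma meanProc_eq (ha₀ : 0 < a₀) (ha : ∀ i, 0 ≤ a i) (hb : ∀ j, 0 ≤ b j)
    {ω : ℤ → Innov} (hω : ∀ t, ⨆ n, ENNReal.ofReal (approxMean a₀ a b n t ω) ≠ ∞) (t : ℤ) :
    meanProc a₀ a b t ω = linMean a₀ a b (fun s => (countProc a₀ a b s ω : ℝ))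
      (fun s => meanProc a₀ a b s ω) t := by
  have h1 := (tendsto_approxMean ha₀ ha hb (hω t)).comp (tendsto_add_atTop_nat 1)
  refine tendsto_nhds_unique h1 ?_
  refine tendsto_linMean (xs := fun n s => (approxCount a₀ a b n s ω : ℝ)) (fun s => ?_)
    (fun s => tendsto_approxMean ha₀ ha hb (hω s)) t
  -- At each site the iterated means approach their limit from below, so the integer counts are
  -- eventually equal to the limit count.
  refine tendsto_const_nhds.congr' ?_
  filter_upwards [eventually_count_eq (tendsto_approxMean ha₀ ha hb (hω s))
    (approxMean_le_meanProc (hω s)) (ω s)] with n hn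
  exact congrArg Nat.cast hn.symm

lemma lintegral_meanProc (hν : ∫⁻ n, (n : ℝ≥0∞) ∂ν = 1)
    (ha₀ : 0 < a₀) (ha : ∀ i, 0 ≤ a i) (hb : ∀ j, 0 ≤ b j) (hab : ∑ i, a i + ∑ j, b j < 1)
    (t : ℤ) : ∫⁻ ω, ENNReal.ofReal (meanProc a₀ a b t ω) ∂(procLaw ν) = limMean a₀ a b := by
  rw [← lintegral_iSup_approxMean hν ha₀ ha hb t]
  refine lintegral_congr_ae ?_
  filter_upwards [ae_iSup_approxMean_ne_top hν ha₀ ha hb hab] with ω hω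
  exact ENNReal.ofReal_toReal (hω t)

lemma integrable_natCast {Ω : Type*} {m : MeasurableSpace Ω} {μ : Measure Ω} {f : Ω → ℕ}
    (hf : Measurable f) (h : ∫⁻ ω, (f ω : ℝ≥0∞) ∂μ ≠ ∞) : Integrable (fun ω => (f ω : ℝ)) μ := by
  refine ⟨(measurable_natCast_real hf).aestronglyMeasurable, ?_⟩
  rw [hasFiniteIntegral_iff_ofReal (Eventually.of_forall fun ω => Nat.cast_nonneg _)]
  simp_rw [ENNReal.ofReal_natCast]
  exact h.lt_top

lemma integrable_countProc (hν : ∫⁻ n, (n : ℝ≥0∞) ∂ν = 1)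
    (ha₀ : 0 < a₀) (ha : ∀ i, 0 ≤ a i) (hb : ∀ j, 0 ≤ b j) (hab : ∑ i, a i + ∑ j, b j < 1)
    (t : ℤ) : Integrable (fun ω => (countProc a₀ a b t ω : ℝ)) (procLaw ν) := by
  refine integrable_natCast ((measurable_countProc a₀ a b t).mono (coordSigma_le _) le_rfl) ?_
  rw [lintegral_countProc hν, lintegral_meanProc hν ha₀ ha hb hab]
  exact limMean_ne_top ha₀ ha hb hab

lemma integrable_approxCount (hν : ∫⁻ n, (n : ℝ≥0∞) ∂ν = 1)
    (ha₀ : 0 < a₀) (ha : ∀ i, 0 ≤ a i) (hb : ∀ j, 0 ≤ b j) (n : ℕ)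
    (t : ℤ) : Integrable (fun ω => (approxCount a₀ a b n t ω : ℝ)) (procLaw ν) := by
  refine integrable_natCast ((measurable_approxCount a₀ a b n t).mono (coordSigma_le _) le_rfl) ?_
  rw [lintegral_approxCount hν ha₀ ha hb, lintegral_approxMean hν ha₀ ha hb]
  exact ENNReal.ofReal_ne_top

/-- The `L¹` error of the `n`-th Picard iterate. -/
noncomputable def picardError (a₀ : ℝ) (a : Fin p → ℝ) (b : Fin q → ℝ) (n : ℕ) : ℝ≥0∞ :=
  limMean a₀ a b - ENNReal.ofReal (a₀ * ∑ k ∈ Finset.range n, (∑ i, a i + ∑ j, b j) ^ k)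

lemma tendsto_picardError (ha₀ : 0 < a₀) (ha : ∀ i, 0 ≤ a i) (hb : ∀ j, 0 ≤ b j)
    (hab : ∑ i, a i + ∑ j, b j < 1) : Tendsto (picardError a₀ a b) atTop (𝓝 0) := by
  have hc : 0 ≤ ∑ i, a i + ∑ j, b j :=
    add_nonneg (Finset.sum_nonneg fun i _ => ha i) (Finset.sum_nonneg fun j _ => hb j)
  have hmono : Monotone fun n =>
      ENNReal.ofReal (a₀ * ∑ k ∈ Finset.range n, (∑ i, a i + ∑ j, b j) ^ k) := fun n m h =>
    ENNReal.ofReal_le_ofReal (mul_le_mul_of_nonneg_left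
      (Finset.sum_le_sum_of_subset_of_nonneg (Finset.range_mono h) fun k _ _ => pow_nonneg hc k)
      ha₀.le)
  have h := ENNReal.Tendsto.sub (tendsto_const_nhds (x := limMean a₀ a b))
    (tendsto_atTop_iSup hmono) (Or.inl (limMean_ne_top ha₀ ha hb hab))
  rw [show (⨆ n, ENNReal.ofReal (a₀ * ∑ k ∈ Finset.range n, (∑ i, a i + ∑ j, b j) ^ k))
    = limMean a₀ a b from rfl, tsub_self] at h
  exact h

/-- The iterates lie below the limit, so the absolute value drops and the distance is a difference
of expectations; no contraction estimate is needed. -/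
lemma lintegral_abs_countProc_sub (hν : ∫⁻ n, (n : ℝ≥0∞) ∂ν = 1)
    (ha₀ : 0 < a₀) (ha : ∀ i, 0 ≤ a i) (hb : ∀ j, 0 ≤ b j) (hab : ∑ i, a i + ∑ j, b j < 1)
    (n : ℕ) (t : ℤ) :
    ∫⁻ ω, ENNReal.ofReal |(countProc a₀ a b t ω : ℝ) - approxCount a₀ a b n t ω| ∂(procLaw ν)
      = picardError a₀ a b n := by
  have hle : ∀ᵐ ω ∂(procLaw ν), approxCount a₀ a b n t ω ≤ countProc a₀ a b t ω := by
    filter_upwards [ae_iSup_approxMean_ne_top hν ha₀ ha hb hab] with ω hω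
    exact count_mono _ (approxMean_le_meanProc (hω t) n)
  have heq : ∀ᵐ ω ∂(procLaw ν),
      ENNReal.ofReal |(countProc a₀ a b t ω : ℝ) - approxCount a₀ a b n t ω|
        = (countProc a₀ a b t ω : ℝ≥0∞) - approxCount a₀ a b n t ω := by
    filter_upwards [hle] with ω hω
    rw [abs_of_nonneg (sub_nonneg.2 (Nat.cast_le.2 hω)),
      ENNReal.ofReal_sub _ (Nat.cast_nonneg _), ENNReal.ofReal_natCast, ENNReal.ofReal_natCast]
  have happ : ∫⁻ ω, (approxCount a₀ a b n t ω : ℝ≥0∞) ∂(procLaw ν)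
      = ENNReal.ofReal (a₀ * ∑ k ∈ Finset.range n, (∑ i, a i + ∑ j, b j) ^ k) := by
    rw [lintegral_approxCount hν ha₀ ha hb, lintegral_approxMean hν ha₀ ha hb]
  rw [lintegral_congr_ae heq, lintegral_sub, happ, lintegral_countProc hν,
    lintegral_meanProc hν ha₀ ha hb hab]
  · rfl
  · exact (measurable_of_countable (fun n : ℕ => (n : ℝ≥0∞))).comp
      ((measurable_approxCount a₀ a b n t).mono (coordSigma_le _) le_rfl)
  · rw [happ]
    exact ENNReal.ofReal_ne_top
  · filter_upwards [hle] with ω hω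
    exact Nat.cast_le.2 hω

end PicardIteration

end CountMEM

namespace CountMEM

/-! ### Weak dependence and ergodicity of the count process. -/

section Dependence

variable {p q : ℕ} {a₀ : ℝ} {a : Fin p → ℝ} {b : Fin q → ℝ} {ν : Measure ℕ}
  [IsProbabilityMeasure ν]

lemma measurable_pi_of_forall {Ω ι E : Type*} {m : MeasurableSpace Ω} [MeasurableSpace E]
    {f : Ω → ι → E} (h : ∀ i, Measurable fun ω => f ω i) : Measurable f :=
  measurable_pi_lambda _ h

/-- Iterate `n` at times `j i ≥ P + r` reads only innovations after `P`, so it is an admissible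
independent copy in `tauCoeff_le`. The `l` equal errors cancel the factor `1/l`. -/
lemma tauInfty_countProc_le (hν : ∫⁻ n, (n : ℝ≥0∞) ∂ν = 1)
    (ha₀ : 0 < a₀) (ha : ∀ i, 0 ≤ a i) (hb : ∀ j, 0 ≤ b j) (hab : ∑ i, a i + ∑ j, b j < 1)
    {n r : ℕ} (hr : n * (p + q) < r) :
    tauInfty (fun t ω => (countProc a₀ a b t ω : ℝ)) (procLaw ν) r ≤ 2 * picardError a₀ a b n := by
  unfold tauInfty
  refine iSup₂_le fun l hl => iSup_le fun P => iSup_le fun j => iSup_le fun _ => iSup_le fun hj => ?_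
  have hX (t : ℤ) : Measurable[coordSigma Innov (Set.Iic t)]
      fun ω => (countProc a₀ a b t ω : ℝ) :=
    measurable_natCast_real (measurable_countProc a₀ a b t)
  have hXn (t : ℤ) : Measurable[coordSigma Innov (Set.Icc (t - n * (p + q)) t)]
      fun ω => (approxCount a₀ a b n t ω : ℝ) :=
    measurable_natCast_real (measurable_approxCount a₀ a b n t)
  have hY : Measurable[coordSigma Innov (Set.Iic P)]
      (pathUpTo (fun t ω => (countProc a₀ a b t ω : ℝ)) P) :=
    measurable_pi_of_forall fun s =>
      (hX s).mono (coordSigma_mono (Set.Iic_subset_Iic.2 s.2)) le_rfl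
  have hZ : Measurable fun ω (i : Fin l) => (countProc a₀ a b (j i) ω : ℝ) :=
    measurable_pi_lambda _ fun i => (hX (j i)).mono (coordSigma_le _) le_rfl
  have hZ' : Measurable[coordSigma Innov (Set.Ioi P)]
      fun ω (i : Fin l) => (approxCount a₀ a b n (j i) ω : ℝ) := by
    refine measurable_pi_of_forall fun i => (hXn (j i)).mono (coordSigma_mono fun s hs => ?_) le_rfl
    have h1 := hs.1
    have h2 := hj i
    have h3 : (n * (p + q) : ℤ) < r := by exact_mod_cast hr
    rw [Set.mem_Ioi]
    linarith
  have hdisj : Disjoint (Set.Iic P) (Set.Ioi P) := by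
    rw [Set.disjoint_left]
    exact fun x hx hx' => absurd (Set.mem_Ioi.1 hx') (not_lt.2 hx)
  have hind : IndepFun (pathUpTo (fun t ω => (countProc a₀ a b t ω : ℝ)) P)
      (fun ω (i : Fin l) => (approxCount a₀ a b n (j i) ω : ℝ)) (procLaw ν) := by
    rw [IndepFun_iff_Indep]
    exact indep_of_indep_of_le (indep_coordSigma (innovLaw ν) hdisj) hY.comap_le hZ'.comap_le
  have hmain := tauCoeff_le (hY.mono (coordSigma_le _) le_rfl) hZ
    (fun i => integrable_countProc hν ha₀ ha hb hab (j i))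
    (hZ'.mono (coordSigma_le _) le_rfl) (fun i => integrable_approxCount hν ha₀ ha hb n (j i)) hind
  have hsum : ∫⁻ ω, ENNReal.ofReal
      (∑ i, |(countProc a₀ a b (j i) ω : ℝ) - approxCount a₀ a b n (j i) ω|) ∂(procLaw ν)
      = l * picardError a₀ a b n := by
    simp_rw [ENNReal.ofReal_sum_of_nonneg fun _ _ => abs_nonneg _]
    rw [lintegral_finsetSum]
    · simp_rw [lintegral_abs_countProc_sub hν ha₀ ha hb hab]
      simp
    · intro i _
      have h1 : Measurable fun ω => (countProc a₀ a b (j i) ω : ℝ) :=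
        (hX (j i)).mono (coordSigma_le _) le_rfl
      have h2 : Measurable fun ω => (approxCount a₀ a b n (j i) ω : ℝ) :=
        (hXn (j i)).mono (coordSigma_le _) le_rfl
      fun_prop
  rw [hsum] at hmain
  refine ENNReal.div_le_of_le_mul (hmain.trans_eq ?_)
  ring

theorem isTauWeaklyDependent_countProc (hν : ∫⁻ n, (n : ℝ≥0∞) ∂ν = 1)
    (ha₀ : 0 < a₀) (ha : ∀ i, 0 ≤ a i) (hb : ∀ j, 0 ≤ b j) (hab : ∑ i, a i + ∑ j, b j < 1) :
    IsTauWeaklyDependent (fun t ω => (countProc a₀ a b t ω : ℝ)) (procLaw ν) := by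
  refine ⟨integrable_countProc hν ha₀ ha hb hab, ENNReal.tendsto_nhds_zero.2 fun δ hδ => ?_⟩
  have h := ENNReal.Tendsto.const_mul (a := 2) (tendsto_picardError ha₀ ha hb hab)
    (Or.inr ENNReal.ofNat_ne_top)
  rw [mul_zero] at h
  obtain ⟨n, hn⟩ := (ENNReal.tendsto_nhds_zero.1 h δ hδ).exists
  filter_upwards [eventually_gt_atTop (n * (p + q))] with r hr
  exact (tauInfty_countProc_le hν ha₀ ha hb hab hr).trans hn

/-- The count path is a shift-equivariant function of the innovations, and ergodicity passes to
factors. -/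
theorem isErgodicProcess_countProc : IsErgodicProcess (countProc a₀ a b) (procLaw ν) := by
  have hm : Measurable fun ω t => countProc a₀ a b t ω :=
    measurable_pi_lambda _ fun t => (measurable_countProc a₀ a b t).mono (coordSigma_le _) le_rfl
  have hg : MeasurePreserving (fun ω t => countProc a₀ a b t ω) (procLaw ν)
      (pathLaw (countProc a₀ a b) (procLaw ν)) := ⟨hm, rfl⟩
  refine hg.ergodic_of_ergodic_semiconj (ergodic_shift (innovLaw ν)) measurable_shift fun ω => ?_
  ext t
  exact countProc_shift a₀ a b t ω

end Dependence

/-! ### Verification of the model equations. -/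

section Solution

variable {p q : ℕ} {a₀ : ℝ} {a : Fin p → ℝ} {b : Fin q → ℝ} {ν : Measure ℕ}
  [IsProbabilityMeasure ν]

lemma measurePreserving_coord (t : ℤ) :
    MeasurePreserving (fun ω : ℤ → Innov => ω t) (procLaw ν) (innovLaw ν) :=
  measurePreserving_eval_infinitePi (fun _ : ℤ => innovLaw ν) t

lemma measurePreserving_innov (t : ℤ) :
    MeasurePreserving (fun ω : ℤ → Innov => (ω t).1) (procLaw ν) ν :=
  measurePreserving_fst.comp (measurePreserving_coord t)

lemma measurePreserving_uniforms (t : ℤ) :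
    MeasurePreserving (fun ω : ℤ → Innov => (ω t).2) (procLaw ν)
      (Measure.infinitePi fun _ : ℕ => (volume : Measure unitInterval)) :=
  measurePreserving_snd.comp (measurePreserving_coord t)

lemma pastSigma_le (t : ℤ) :
    pastSigma (countProc a₀ a b) (meanProc a₀ a b) t ≤ coordSigma Innov (Set.Iio t) := by
  refine iSup₂_le fun s hs => Measurable.comap_le ?_
  exact ((measurable_countProc a₀ a b s).mono (coordSigma_mono (Set.Iic_subset_Iio.2 hs))
    le_rfl).prodMk ((measurable_meanProc a₀ a b s).mono (coordSigma_mono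
      (Set.Iio_subset_Iio hs.le)) le_rfl)

lemma measurable_pastSigma {Ω : Type*} (X : ℤ → Ω → ℕ) (M : ℤ → Ω → ℝ) {s t : ℤ} (hs : s < t) :
    Measurable[pastSigma X M t] (X s) ∧ Measurable[pastSigma X M t] (M s) := by
  have h : Measurable[pastSigma X M t] fun ω => (X s ω, M s ω) :=
    Measurable.of_comap_le (le_iSup₂_of_le s hs le_rfl)
  exact ⟨h.fst, h.snd⟩

/-- The uniform variables at time `t` are independent of the past and of the innovation. -/
lemma indep_past_sup_innov (t : ℤ) :
    Indep (coordSigma Innov (Set.Iio t) ⊔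
        MeasurableSpace.comap (fun ω : ℤ → Innov => (ω t).1) inferInstance)
      (MeasurableSpace.comap (fun ω : ℤ → Innov => (ω t).2) inferInstance) (procLaw ν) := by
  -- The past is gathered into one variable so that `IndepFun.prodMk_left` can adjoin the current
  -- innovation to it.
  set F : (ℤ → Innov) → (Set.Iio t → Innov) := fun ω s => ω s
  have hFm : Measurable[coordSigma Innov (Set.Iio t)] F :=
    measurable_pi_of_forall fun s => measurable_coord s.2
  have hdisj : Disjoint (Set.Iio t) {t} := by simp
  have h : IndepFun F (fun ω : ℤ → Innov => ((ω t).1, (ω t).2)) (procLaw ν) := by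
    rw [IndepFun_iff_Indep]
    exact indep_of_indep_of_le (indep_coordSigma (innovLaw ν) hdisj) hFm.comap_le
      (measurable_coord (Set.mem_singleton t)).comap_le
  have h' : IndepFun (fun ω : ℤ → Innov => (ω t).1) (fun ω : ℤ → Innov => (ω t).2)
      (procLaw ν) := by
    rw [indepFun_iff_map_prod_eq_prod_map_map
      (measurePreserving_innov (ν := ν) t).measurable.aemeasurable
      (measurePreserving_uniforms (ν := ν) t).measurable.aemeasurable, (measurePreserving_innov t).map_eq,
      (measurePreserving_uniforms t).map_eq]
    exact (measurePreserving_coord t).map_eq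
  have h2 := IndepFun.prodMk_left (hFm.mono (coordSigma_le _) le_rfl)
    (measurePreserving_innov (ν := ν) t).measurable
    (measurePreserving_uniforms (ν := ν) t).measurable h h'
  rw [IndepFun_iff_Indep] at h2
  refine indep_of_indep_of_le_left h2 (sup_le (iSup₂_le fun s hs => ?_) ?_)
  · refine Measurable.comap_le ?_
    exact (measurable_pi_apply (X := fun _ : Set.Iio t => Innov) ⟨s, hs⟩).comp
      (measurable_fst.comp (comap_measurable fun ω => (F ω, (ω t).1)))
  · exact Measurable.comap_le (measurable_snd.comp (comap_measurable _))

/-- The σ-field generated by the past of the count process and by the current innovation. -/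
@[reducible] noncomputable def infoSigma (a₀ : ℝ) (a : Fin p → ℝ) (b : Fin q → ℝ) (t : ℤ) :
    MeasurableSpace (ℤ → Innov) :=
  pastSigma (countProc a₀ a b) (meanProc a₀ a b) t ⊔
    MeasurableSpace.comap (fun ω : ℤ → Innov => (ω t).1) inferInstance

theorem isBinomialCMEM_countProc (hν : ∫⁻ n, (n : ℝ≥0∞) ∂ν = 1)
    (ha₀ : 0 < a₀) (ha : ∀ i, 0 ≤ a i) (hb : ∀ j, 0 ≤ b j) (hab : ∑ i, a i + ∑ j, b j < 1) :
    IsBinomialCMEM (procLaw ν) a₀ a b ν (countProc a₀ a b) (meanProc a₀ a b)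
      (fun t ω => (ω t).1) where
  measurable_X t := (measurable_countProc a₀ a b t).mono (coordSigma_le _) le_rfl
  measurable_M t := (measurable_meanProc a₀ a b t).mono (coordSigma_le _) le_rfl
  measurable_ε t := (measurePreserving_innov (ν := ν) t).measurable
  iIndep_ε := iIndepFun_infinitePi (P := fun _ : ℤ => innovLaw ν) (X := fun _ x => x.1)
    fun _ => measurable_fst
  law_ε t := (measurePreserving_innov t).map_eq
  indep_past t := by
    have hdisj : Disjoint {t} (Set.Iio t) := by simp
    refine indep_of_indep_of_le (indep_coordSigma (innovLaw ν) hdisj) ?_ (pastSigma_le t)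
    exact Measurable.comap_le (measurable_fst.comp (measurable_coord (Set.mem_singleton t)))
  pos_M t := by
    filter_upwards [ae_iSup_approxMean_ne_top hν ha₀ ha hb hab] with ω hω
    rw [meanProc_eq ha₀ ha hb hω]
    exact ha₀.trans_le (le_linMean ha hb (fun s => Nat.cast_nonneg _)
      (fun s => ENNReal.toReal_nonneg) t)
  mean_eq t := by
    filter_upwards [ae_iSup_approxMean_ne_top hν ha₀ ha hb hab] with ω hω
    exact meanProc_eq ha₀ ha hb hω t
  binomial_eq t := by
    -- The past σ-field is generated by the pairs at times `s < t` only, and `meanProc` at `t`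
    -- agrees with a function of these only almost surely. The version `N` is exactly measurable, as
    -- the conditional expectation argument requires.
    set N : (ℤ → Innov) → ℝ := fun ω => linMean a₀ a b (fun s => (countProc a₀ a b s ω : ℝ))
      (fun s => meanProc a₀ a b s ω) t
    have hNM : ∀ᵐ ω ∂(procLaw ν), meanProc a₀ a b t ω = N ω := by
      filter_upwards [ae_iSup_approxMean_ne_top hν ha₀ ha hb hab] with ω hω
      exact meanProc_eq ha₀ ha hb hω t
    have hNm : Measurable[infoSigma a₀ a b t] N := by
      have h : Measurable[pastSigma (countProc a₀ a b) (meanProc a₀ a b) t] N :=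
        measurable_linMean (x := fun s ω => (countProc a₀ a b s ω : ℝ))
          (fun i => measurable_natCast_real (measurable_pastSigma _ _ (by omega)).1)
          (fun j => (measurable_pastSigma _ _ (by omega)).2)
      exact h.mono le_sup_left le_rfl
    have hεm : Measurable[infoSigma a₀ a b t] fun ω : ℤ → Innov => (ω t).1 :=
      (comap_measurable _).mono le_sup_right le_rfl
    have hAm : Measurable[infoSigma a₀ a b t] fun ω : ℤ → Innov => (Int.fract (N ω), (ω t).1) :=
      (measurable_fract.comp hNm).prodMk hεm
    have hind : Indep (infoSigma a₀ a b t) (MeasurableSpace.comap (fun ω : ℤ → Innov => (ω t).2) inferInstance)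
        (procLaw ν) :=
      indep_of_indep_of_le_left (indep_past_sup_innov t) (sup_le_sup_right (pastSigma_le t) _)
    have hmle : infoSigma a₀ a b t ≤ MeasurableSpace.pi :=
      sup_le ((pastSigma_le t).trans (coordSigma_le _))
        (measurePreserving_innov (ν := ν) t).measurable.comap_le
    have hV := (measurePreserving_uniforms (ν := ν) t)
    refine ⟨fun ω => thin (Int.fract (N ω)) (ω t).1 (ω t).2,
      measurable_thin.comp ((hAm.mono hmle le_rfl).prodMk hV.measurable), ?_, fun k => ?_⟩
    · filter_upwards [hNM, (measurePreserving_coord t).quasiMeasurePreserving.ae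
        (ae_innovLaw_lt_one ν)] with ω hω hlt
      have h0 : 0 ≤ meanProc a₀ a b t ω := ENNReal.toReal_nonneg
      rw [countProc, count_eq_floor_add_thin h0 hlt, ← hω]
      push_cast
      rw [Int.natCast_floor_eq_floor h0]
    · have hs : MeasurableSet {y : (ℝ × ℕ) × (ℕ → unitInterval) | thin y.1.1 y.1.2 y.2 = k} :=
        measurable_thin (measurableSet_singleton k)
      -- The uniforms at `t` are independent of the conditioning, so the conditional law is that of
      -- thinning with frozen parameters.
      have h := condExp_indicator_of_indep (μ := procLaw ν) hmle hAm hV.measurable hind hs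
      refine h.trans ?_
      filter_upwards [hNM] with ω hω
      rw [hω, hV.map_eq, ← map_thin, map_measureReal_apply _ (measurableSet_singleton k)]
      · rfl
      · have h2 : Measurable fun u : ℕ → unitInterval =>
            ((((fracPart (N ω) : unitInterval) : ℝ), (ω t).1), u) := by fun_prop
        exact measurable_thin.comp h2

end Solution

end CountMEM

theorem mainTheorem2 (p q : ℕ) (hp : 1 ≤ p)
    (a₀ : ℝ) (a : Fin p → ℝ) (b : Fin q → ℝ)
    (ha₀ : 0 < a₀) (ha : ∀ i, 0 ≤ a i) (hb : ∀ j, 0 ≤ b j)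
    (ν : Measure ℕ) [IsProbabilityMeasure ν]
    (hν_sq : MemLp (fun n : ℕ => (n : ℝ)) 2 ν) (hν_mean : ∫ n : ℕ, (n : ℝ) ∂ν = 1)
    (hab : ∑ i, a i + ∑ j, b j < 1) :
    ∃ (Ω : Type) (_ : MeasurableSpace Ω) (μ : Measure Ω) (_ : IsProbabilityMeasure μ)
      (X : ℤ → Ω → ℕ) (M : ℤ → Ω → ℝ) (ε : ℤ → Ω → ℕ),
      CountMEM.IsBinomialCMEM μ a₀ a b ν X M ε ∧
      CountMEM.IsTauWeaklyDependent (fun t ω => (X t ω : ℝ)) μ ∧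
      CountMEM.IsStationaryProcess X μ ∧
      CountMEM.IsErgodicProcess X μ := by
  have hν : ∫⁻ n, (n : ℝ≥0∞) ∂ν = 1 := by
    have h := ofReal_integral_eq_lintegral_ofReal (hν_sq.integrable one_le_two)
      (Eventually.of_forall fun n => Nat.cast_nonneg n)
    simp_rw [hν_mean, ENNReal.ofReal_natCast] at h
    rw [← h, ENNReal.ofReal_one]
  -- Ergodicity contains invariance of the path law, so it also supplies stationarity.
  have herg := CountMEM.isErgodicProcess_countProc (a₀ := a₀) (a := a) (b := b) (ν := ν)
  exact ⟨_, inferInstance, CountMEM.procLaw ν, inferInstance, CountMEM.countProc a₀ a b,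
    CountMEM.meanProc a₀ a b, fun t ω => (ω t).1,
    CountMEM.isBinomialCMEM_countProc hν ha₀ ha hb hab,
    CountMEM.isTauWeaklyDependent_countProc hν ha₀ ha hb hab, herg.toMeasurePreserving, herg⟩
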